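/- Let $n\ge 3$, let $G$ be one of $O(n)$, $SO(n)$, $\mathrm{Spin}(n)$, with Lie algebra $\mathfrak g$, let $\mathcal K(X,Y)=\operatorname{tr}(\operatorname{ad}_X\operatorname{ad}_Y)$ be the Killing form of $\mathfrak g$, let $c\in\mathbb R\setminus\{0\}$ and put $\langle\cdot,\cdot\rangle=c\,\mathcal K$. Here $\mathrm{Spin}(n)$ is the group of products of an even number of unit vectors in the Clifford algebra of $\mathbb R^n$ with $v^2=-|v|^2$, and $\mathfrak{spin}(n)$ is identified with $\mathfrak{so}(n)$ by the differential of $\pi(g)v=gvg^{-1}$. *The symplectic form.* Let $BG_p=G^p$ be the nerve of $G$, with face maps $d_0(g_1,g_2)=g_2$ and $d_2(g_1,g_2)=g_1$ from $BG_2$ to $BG_1$. Let $\omega^l_g(X)=g^{-1}X$ and $\omega^r_g(X)=Xg^{-1}$ be the Maurer--Cartan forms of $G$. For a $j$-form $\varphi$ and a $k$-form $\psi$ with coefficients paired by a bilinear map, $\varphi\wedge\psi$ is defined with the normalization $\frac1{j!k!}\sum_\sigma \operatorname{sgn}(\sigma)$ (sum over all permutations of the $j+k$ arguments). Let $$\Psi=\Bigl(0,\;-\tfrac16\langle\omega^l\wedge[\omega^l\wedge\omega^l]\rangle,\;\langle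 d_0^*\omega^l\wedge d_2^*\omega^r\rangle,\;0,\;0\Bigr)\in\bigoplus_{p+q=4}\Omega^q(BG_p),$$ listed for $p=0,1,2,3,4$. *The Pontryagin representative.* Let $p_1$ be the symmetric bilinear form on $\mathfrak{so}(n)$ such that $p_1(A,A)$ is the coefficient of $t^{n-2}$ in $\det(t-\tfrac{A}{2\pi})$; it is regarded as a form on $\mathfrak g$. Let $EG_p=G^{p+1}$, let $\gamma:EG_p\to BG_p$ be $\gamma(g_0,\dots,g_p)=(g_1g_0^{-1},\dots,g_pg_{p-1}^{-1})$, and let $\omega_j$ be the pullback of $\omega^l$ along the $j$-th projection $EG_p\to G$. On $\Delta^p\times EG_p$ consider the connection $\omega=\sum_{j=0}^p t_j\omega_j$, where $t_0,\dots,t_p$ are the barycentric coordinates, and its curvature $\kappa=d\omega+\tfrac12[\omega\wedge\omega]$. For $p+q=4$ let $\chi_p\in\Omega^q(EG_p)$ be the fibre integral $$\chi_p(u_1,\dots,u_q)=\int_{\Delta^p}p_1(\kappa\wedge\kappa)\Bigl(\tfrac{\partial}{\partial t_1},\dots,\tfrac{\partial}{\partial t_p},u_1,\dots,u_q\Bigr)\,dt_1\cdots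 dt_p .$$ **Statement.** There is exactly one element $\Phi=(\Phi_p)_p\in\bigoplus_{p+q=4}\Omega^q(BG_p)$ with $\gamma^*\Phi_p=\chi_p$ for all $p$ (the representative of the first Pontryagin class on $BG_\bullet$), and $$\Phi=-\frac{1}{8(n-2)c\pi^2}\,\Psi .$$ -/

import Mathlib

open scoped ContDiff Matrix.Norms.Operator

noncomputable section

namespace BGForms

section LieGroup

variable {A : Type*} [NormedRing A] [NormedAlgebra ℝ A]

/-- The element of the algebra `A` underlying an element of a group `G` of units of `A`. -/
abbrev el {G : Subgroup Aˣ} (g : G) : A := ((g : Aˣ) : A)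

/-- `X` is the velocity at time `0` of a smooth curve in `A` that stays in the group `G` and
passes through `g` at time `0`. -/
def IsVelocity (G : Subgroup Aˣ) (g : G) (X : A) : Prop :=
  ∃ c : ℝ → G, ContDiff ℝ ∞ (fun t => el (c t)) ∧ c 0 = g ∧ HasDerivAt (fun t => el (c t)) X 0

variable {G : Subgroup Aˣ}

theorem isVelocity_zero (g : G) : IsVelocity G g 0 :=
  ⟨fun _ => g, contDiff_const, rfl, hasDerivAt_const _ _⟩

theorem IsVelocity.mul_left {g : G} {X : A} (hX : IsVelocity G g X) (k : G) :
    IsVelocity G (k * g) (el k * X) := by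
  obtain ⟨c, hc, rfl, hcX⟩ := hX
  refine ⟨fun t => k * c t, ?_, rfl, ?_⟩
  · simpa [el] using contDiff_const.mul hc
  · simpa [el] using hcX.const_mul (el k)

theorem IsVelocity.mul_right {g : G} {X : A} (hX : IsVelocity G g X) (k : G) :
    IsVelocity G (g * k) (X * el k) := by
  obtain ⟨c, hc, rfl, hcX⟩ := hX
  refine ⟨fun t => c t * k, ?_, rfl, ?_⟩
  · simpa [el] using hc.mul contDiff_const
  · simpa [el] using hcX.mul_const (el k)

theorem IsVelocity.smul {g : G} {X : A} (hX : IsVelocity G g X) (a : ℝ) :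
    IsVelocity G g (a • X) := by
  obtain ⟨c, hc, rfl, hcX⟩ := hX
  refine ⟨fun t => c (a * t), ?_, by simp, ?_⟩
  · exact hc.comp (contDiff_const.mul contDiff_id)
  · have h : HasDerivAt (fun t : ℝ => a * t) a 0 := by
      simpa using (hasDerivAt_id (0 : ℝ)).const_mul a
    have hcX' : HasDerivAt (fun t => el (c t)) X (a * 0) := by simpa using hcX
    exact hcX'.scomp (0 : ℝ) h

variable [FiniteDimensional ℝ A]

theorem contDiff_el_inv {c : ℝ → G} (hc : ContDiff ℝ ∞ (fun t => el (c t))) :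
    ContDiff ℝ ∞ (fun t => el (c t)⁻¹) := by
  have : CompleteSpace A := FiniteDimensional.complete ℝ A
  rw [contDiff_iff_contDiffAt]
  intro t
  have h := (contDiffAt_ringInverse (n := ∞) ℝ (c t : Aˣ)).comp t hc.contDiffAt
  refine h.congr_of_eventuallyEq (Filter.Eventually.of_forall fun s => ?_)
  simp [el]

theorem hasDerivAt_el_inv {c : ℝ → G} {X : A} (hX : HasDerivAt (fun t => el (c t)) X 0) :
    HasDerivAt (fun t => el (c t)⁻¹) (-(el (c 0)⁻¹ * X * el (c 0)⁻¹)) 0 := by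
  have : CompleteSpace A := FiniteDimensional.complete ℝ A
  have h := (hasFDerivAt_ringInverse (𝕜 := ℝ) (c 0 : Aˣ)).comp_hasDerivAt (0 : ℝ) hX
  refine (h.congr_of_eventuallyEq (Filter.Eventually.of_forall fun s => ?_)).congr_deriv ?_
  · simp [el]
  · simp [el, mul_assoc]

/-- The derivative of `(c, d) ↦ c d⁻¹` along curves in `G`. -/
theorem hasDerivAt_el_div {c d : ℝ → G} {X Y : A} (hX : HasDerivAt (fun t => el (c t)) X 0)
    (hY : HasDerivAt (fun t => el (d t)) Y 0) :
    HasDerivAt (fun t => el (c t * (d t)⁻¹))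
      (X * el (d 0)⁻¹ - el (c 0 * (d 0)⁻¹) * (Y * el (d 0)⁻¹)) 0 := by
  refine ((hX.mul (hasDerivAt_el_inv hY)).congr_of_eventuallyEq
    (Filter.Eventually.of_forall fun s => ?_)).congr_deriv ?_
  · simp [el]
  · simp [el, mul_assoc, sub_eq_add_neg]

theorem IsVelocity.div {g h : G} {X Y : A} (hX : IsVelocity G g X) (hY : IsVelocity G h Y) :
    IsVelocity G (g * h⁻¹) (X * el h⁻¹ - el (g * h⁻¹) * (Y * el h⁻¹)) := by
  obtain ⟨c, hc, rfl, hcX⟩ := hX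
  obtain ⟨d, hd, rfl, hdY⟩ := hY
  refine ⟨fun t => c t * (d t)⁻¹, ?_, rfl, hasDerivAt_el_div hcX hdY⟩
  simpa [el] using hc.mul (contDiff_el_inv hd)

theorem IsVelocity.add {g : G} {X Y : A} (hX : IsVelocity G g X) (hY : IsVelocity G g Y) :
    IsVelocity G g (X + Y) := by
  have h1 := (isVelocity_zero (1 : G)).div (hY.mul_left g⁻¹)
  have h2 := hX.div h1
  simpa [el, mul_assoc] using h2

/-- The tangent space `T_g G ⊆ A`: all velocities at `g` of smooth curves in `G`. -/
def tangentAt (G : Subgroup Aˣ) (g : G) : Submodule ℝ A where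
  carrier := {X | IsVelocity G g X}
  zero_mem' := isVelocity_zero g
  add_mem' := fun hX hY => IsVelocity.add hX hY
  smul_mem' := fun a _ hX => IsVelocity.smul hX a

attribute [local instance 10] LieRing.ofAssociativeRing

theorem lie_mem_tangentAt_one {X Y : A} (hX : X ∈ tangentAt G 1) (hY : Y ∈ tangentAt G 1) :
    ⁅X, Y⁆ ∈ tangentAt G 1 := by
  obtain ⟨c, hc, hc0, hcX⟩ := hX
  have hmem : ∀ t, el (c t) * Y * el (c t)⁻¹ ∈ tangentAt G 1 := by
    intro t
    have h := (IsVelocity.mul_left hY (c t)).mul_right (c t)⁻¹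
    have e : c t * 1 * (c t)⁻¹ = 1 := by group
    rw [e] at h
    exact h
  have hd : HasDerivAt (fun t => el (c t) * Y * el (c t)⁻¹) ⁅X, Y⁆ 0 := by
    refine ((hcX.mul_const Y).mul (hasDerivAt_el_inv hcX)).congr_deriv ?_
    simp [el, hc0, Ring.lie_def, sub_eq_add_neg]
  have hcl : IsClosed ((tangentAt G 1 : Submodule ℝ A) : Set A) :=
    Submodule.closed_of_finiteDimensional _
  refine hcl.mem_of_tendsto hd.tendsto_slope (Filter.Eventually.of_forall fun t => ?_)
  rw [slope_def_module]
  exact Submodule.smul_mem _ _ (Submodule.sub_mem _ (hmem t) (hmem 0))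

/-- The Lie algebra `𝔤 = T_1 G` of `G`, with the commutator bracket. -/
def lieAlg (G : Subgroup Aˣ) : LieSubalgebra ℝ A where
  toSubmodule := tangentAt G 1
  lie_mem' := fun hX hY => lie_mem_tangentAt_one hX hY

/-- The left Maurer-Cartan form `ω^l_g(X) = (L_{g⁻¹})_* X = g⁻¹ X`. -/
def maurerCartanLeft (g : G) : tangentAt G g →ₗ[ℝ] lieAlg G :=
  ((LinearMap.mulLeft ℝ (el g⁻¹)).comp (tangentAt G g).subtype).codRestrict
    (lieAlg G).toSubmodule (fun X => by
      have h := IsVelocity.mul_left X.2 g⁻¹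
      rw [inv_mul_cancel] at h
      exact h)

/-- The right Maurer-Cartan form `ω^r_g(X) = (R_{g⁻¹})_* X = X g⁻¹`. -/
def maurerCartanRight (g : G) : tangentAt G g →ₗ[ℝ] lieAlg G :=
  ((LinearMap.mulRight ℝ (el g⁻¹)).comp (tangentAt G g).subtype).codRestrict
    (lieAlg G).toSubmodule (fun X => by
      have h := IsVelocity.mul_right X.2 g⁻¹
      rw [mul_inv_cancel] at h
      exact h)

theorem coe_maurerCartanLeft (g : G) (X : tangentAt G g) :
    (maurerCartanLeft g X : A) = el g⁻¹ * X := rfl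

theorem coe_maurerCartanRight (g : G) (X : tangentAt G g) :
    (maurerCartanRight g X : A) = X * el g⁻¹ := rfl

end LieGroup

section Wedge

variable {M F F' F'' : Type*} [AddCommGroup M] [Module ℝ M] [AddCommGroup F] [Module ℝ F]
  [AddCommGroup F'] [Module ℝ F'] [AddCommGroup F''] [Module ℝ F'']

/-- The wedge product of vector-valued alternating forms with respect to a bilinear pairing `B`
of the coefficients:
`(φ ∧ ψ)(v) = 1/(j! k!) ∑_σ sign(σ) B(φ(v_σ(1), …, v_σ(j)), ψ(v_σ(j+1), …, v_σ(j+k)))`. -/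
def wedge {j k : ℕ} (B : F →ₗ[ℝ] F' →ₗ[ℝ] F'') (φ : M [⋀^Fin j]→ₗ[ℝ] F)
    (ψ : M [⋀^Fin k]→ₗ[ℝ] F') : M [⋀^Fin (j + k)]→ₗ[ℝ] F'' :=
  ((j.factorial * k.factorial : ℝ)⁻¹) • MultilinearMap.alternatization
    (((TensorProduct.lift B).compMultilinearMap
      (φ.toMultilinearMap.domCoprod ψ.toMultilinearMap)).domDomCongr finSumFinEquiv)

theorem wedge_apply {j k : ℕ} (B : F →ₗ[ℝ] F' →ₗ[ℝ] F'') (φ : M [⋀^Fin j]→ₗ[ℝ] F)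
    (ψ : M [⋀^Fin k]→ₗ[ℝ] F') (v : Fin (j + k) → M) :
    wedge B φ ψ v = ((j.factorial * k.factorial : ℝ)⁻¹) •
      ∑ σ : Equiv.Perm (Fin (j + k)), (Equiv.Perm.sign σ : ℤ) •
        B (φ fun i => v (σ (Fin.castAdd k i))) (ψ fun i => v (σ (Fin.natAdd j i))) := by
  simp [wedge, MultilinearMap.alternatization_apply, MultilinearMap.domCoprod_apply,
    Units.smul_def]

end Wedge

section Classifying

variable {A : Type*} [NormedRing A] [NormedAlgebra ℝ A] [FiniteDimensional ℝ A]

attribute [local instance 10] LieRing.ofAssociativeRing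

/-- The tangent space of `G^m` at `g`. -/
abbrev Tan (G : Subgroup Aˣ) {m : ℕ} (g : Fin m → G) : Type _ := ∀ i, tangentAt G (g i)

/-- `q`-forms on the manifold `G^m` with values in `F` (tensor fields, pointwise). -/
abbrev Form (G : Subgroup Aˣ) (m q : ℕ) (F : Type*) [AddCommGroup F] [Module ℝ F] : Type _ :=
  ∀ g : Fin m → G, Tan G g [⋀^Fin q]→ₗ[ℝ] F

/-- Forms of total degree `N` on the simplicial manifold `BG_•`, `BG_p = G^p`:
families of a `q`-form on `BG_p` for all `p + q = N`. -/
abbrev Tot (G : Subgroup Aˣ) (N : ℕ) : Type _ :=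
  ∀ pq : {pq : ℕ × ℕ // pq.1 + pq.2 = N}, Form G pq.1.1 pq.1.2 ℝ

variable (G : Subgroup Aˣ)

/-- The bracket of the Lie algebra as a bilinear map. -/
def bracket : lieAlg G →ₗ[ℝ] lieAlg G →ₗ[ℝ] lieAlg G :=
  (LieAlgebra.ad ℝ (lieAlg G) : lieAlg G →ₗ[ℝ] Module.End ℝ (lieAlg G))

/-- The pullback of `ω^l` along the `i`-th projection `G^m → G`. -/
def leftForm (m : ℕ) (i : Fin m) : Form G m 1 (lieAlg G) := fun g =>
  AlternatingMap.ofSubsingleton ℝ _ _ (0 : Fin 1) ((maurerCartanLeft (g i)).comp (LinearMap.proj i))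

/-- The pullback of `ω^r` along the `i`-th projection `G^m → G`. -/
def rightForm (m : ℕ) (i : Fin m) : Form G m 1 (lieAlg G) := fun g =>
  AlternatingMap.ofSubsingleton ℝ _ _ (0 : Fin 1) ((maurerCartanRight (g i)).comp (LinearMap.proj i))

/-- The form `Ψ = (0, -1/6 ⟨ω^l, [ω^l ∧ ω^l]⟩, ⟨d_0^* ω^l, d_2^* ω^r⟩, 0, 0)` on `BG_•`. The face
maps `BG_2 → BG_1` are `d_0(g_1, g_2) = g_2` and `d_2(g_1, g_2) = g_1`. -/
def symplecticForm (B : LinearMap.BilinForm ℝ (lieAlg G)) : Tot G 4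
  | ⟨(1, 3), _⟩ => fun g =>
      (-(1 / 6 : ℝ)) • wedge (j := 1) (k := 2) B (leftForm G 1 0 g)
        (wedge (j := 1) (k := 1) (bracket G) (leftForm G 1 0 g) (leftForm G 1 0 g))
  | ⟨(2, 2), _⟩ => fun g => wedge (j := 1) (k := 1) B (leftForm G 2 1 g) (rightForm G 2 0 g)
  | _ => 0

/-- The standard simplex `Δ^p`, in the coordinates `(t_1, …, t_p)`. -/
def simplex (p : ℕ) : Set (Fin p → ℝ) := {t | (∀ i, 0 ≤ t i) ∧ ∑ i, t i ≤ 1}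

/-- The barycentric coordinates `(t_0, t_1, …, t_p)`, `t_0 = 1 - ∑ t_i`. -/
def bary {p : ℕ} (t : Fin p → ℝ) : Fin (p + 1) → ℝ := Fin.cons (1 - ∑ i, t i) t

/-- The tangent space of `Δ^p × EG_p` at a point over `g`, where `EG_p = G^{p+1}`. -/
abbrev TanE {p : ℕ} (g : Fin (p + 1) → G) : Type _ := (Fin p → ℝ) × Tan G g

/-- The canonical connection `∑_j t_j ω_j` on `Δ^p × EG_p`. -/
def connection {p : ℕ} (t : Fin p → ℝ) (g : Fin (p + 1) → G) :
    TanE G g [⋀^Fin 1]→ₗ[ℝ] lieAlg G :=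
  AlternatingMap.ofSubsingleton ℝ _ _ (0 : Fin 1)
    (∑ j, bary t j • (maurerCartanLeft (g j)).comp
      ((LinearMap.proj j).comp (LinearMap.snd ℝ (Fin p → ℝ) (Tan G g))))

/-- The inclusion of the tangent space of `Δ^p × EG_p` in the ambient space. -/
def inclE {p : ℕ} (g : Fin (p + 1) → G) : TanE G g →ₗ[ℝ] (Fin p → ℝ) × (Fin (p + 1) → A) :=
  LinearMap.prodMap LinearMap.id (LinearMap.pi fun j => (tangentAt G (g j)).subtype.comp
    (LinearMap.proj j))

/-- The extension of the canonical connection to an `A`-valued `1`-form, smooth near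
`Δ^p × EG_p`, on the ambient space `ℝ^p × A^{p+1}`:
`(s, X) ↦ ∑_j t_j a_j⁻¹ X_j` at the point `(t, a)`. -/
def ambientConnection (A : Type*) [NormedRing A] [NormedAlgebra ℝ A] (p : ℕ)
    (x : (Fin p → ℝ) × (Fin (p + 1) → A)) :
    ((Fin p → ℝ) × (Fin (p + 1) → A)) [⋀^Fin 1]→L[ℝ] A :=
  ContinuousAlternatingMap.ofSubsingleton ℝ _ _ (0 : Fin 1)
    (∑ j, bary x.1 j • (ContinuousLinearMap.mul ℝ A (Ring.inverse (x.2 j))).comp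
      ((ContinuousLinearMap.proj j).comp (ContinuousLinearMap.snd ℝ _ _)))


theorem ambientConnection_restrict {p : ℕ} (t : Fin p → ℝ) (g : Fin (p + 1) → G)
    (v : Fin 1 → TanE G g) :
    ambientConnection A p (t, fun j => el (g j)) (fun i => inclE G g (v i)) =
      (connection G t g v : A) := by
  simp [ambientConnection, connection, inclE, coe_maurerCartanLeft, el]

/-- The differential of `bary`. -/
def dbary {p : ℕ} (s : Fin p → ℝ) : Fin (p + 1) → ℝ := Fin.cons (-∑ i, s i) s

theorem hasFDerivAt_bary {p : ℕ} (t : Fin p → ℝ) (j : Fin (p + 1)) :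
    ∃ D : (Fin p → ℝ) →L[ℝ] ℝ, HasFDerivAt (fun s => bary s j) D t ∧
      ∀ s, D s = dbary s j := by
  refine Fin.cases ?_ (fun i => ?_) j
  · refine ⟨-∑ i, ContinuousLinearMap.proj i, ?_, fun s => by simp [dbary]⟩
    have h := (HasFDerivAt.fun_sum (u := Finset.univ)
      (fun i _ => hasFDerivAt_apply (𝕜 := ℝ) (F' := fun _ : Fin p => ℝ) i t)).const_sub 1
    simpa only [bary, Fin.cons_zero] using h
  · refine ⟨ContinuousLinearMap.proj i, ?_, fun s => by simp [dbary]⟩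
    simpa only [bary, Fin.cons_succ] using
      hasFDerivAt_apply (𝕜 := ℝ) (F' := fun _ : Fin p => ℝ) i t

theorem differentiableAt_ofSubsingleton_sum {A E : Type*} [NormedRing A] [NormedAlgebra ℝ A]
    [NormedAddCommGroup E] [NormedSpace ℝ E] {m : ℕ} (f : Fin m → E → ℝ) (a : Fin m → E → A)
    (P : Fin m → E →L[ℝ] A) (x : E) (hf : ∀ j, DifferentiableAt ℝ (f j) x)
    (ha : ∀ j, DifferentiableAt ℝ (a j) x) :
    DifferentiableAt ℝ (fun x => ContinuousAlternatingMap.ofSubsingleton ℝ E A (0 : Fin 1)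
      (∑ j, f j x • (ContinuousLinearMap.mul ℝ A (a j x)).comp (P j))) x := by
  have h3 : DifferentiableAt ℝ (fun x =>
      ∑ j, f j x • (ContinuousLinearMap.mul ℝ A (a j x)).comp (P j)) x := by
    refine DifferentiableAt.fun_sum fun j _ => (hf j).smul ?_
    refine DifferentiableAt.clm_comp ?_ (differentiableAt_const _)
    exact (ContinuousLinearMap.mul ℝ A).differentiableAt.comp x (ha j)
  exact ((ContinuousAlternatingMap.ofSubsingletonLIE (𝕜 := ℝ) (E := E) (F := A)
    (i := (0 : Fin 1))).toContinuousLinearEquiv.differentiableAt).comp x h3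

set_option maxHeartbeats 800000 in
theorem differentiableAt_ambientConnection {p : ℕ} (t : Fin p → ℝ) (g : Fin (p + 1) → G) :
    DifferentiableAt ℝ (ambientConnection A p) (t, fun j => el (g j)) ∧
    ∀ (u : (Fin p → ℝ) × (Fin (p + 1) → A)) (w : Fin 1 → (Fin p → ℝ) × (Fin (p + 1) → A)),
      fderiv ℝ (fun x => ambientConnection A p x w) (t, fun j => el (g j)) u =
        ∑ j, (dbary u.1 j • (el (g j)⁻¹ * (w 0).2 j) -
          bary t j • (el (g j)⁻¹ * u.2 j * (el (g j)⁻¹ * (w 0).2 j))) := by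
  have : CompleteSpace A := FiniteDimensional.complete ℝ A
  choose D hD hD' using hasFDerivAt_bary t
  set x₀ : (Fin p → ℝ) × (Fin (p + 1) → A) := (t, fun j => el (g j)) with hx₀
  have h1 : ∀ j, HasFDerivAt (fun x : (Fin p → ℝ) × (Fin (p + 1) → A) => bary x.1 j)
      ((D j).comp (ContinuousLinearMap.fst ℝ _ _)) x₀ := fun j =>
    HasFDerivAt.comp (g := fun s => bary s j) (f := Prod.fst) x₀ (hD j) hasFDerivAt_fst
  have h2 : ∀ j, HasFDerivAt (fun x : (Fin p → ℝ) × (Fin (p + 1) → A) => Ring.inverse (x.2 j))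
      ((-ContinuousLinearMap.mulLeftRight ℝ A (el (g j)⁻¹) (el (g j)⁻¹)).comp
        ((ContinuousLinearMap.proj (R := ℝ) (φ := fun _ => A) j).comp
          (ContinuousLinearMap.snd ℝ _ _))) x₀ := fun j =>
    HasFDerivAt.comp (g := Ring.inverse) (f := fun x : (Fin p → ℝ) × (Fin (p + 1) → A) => x.2 j) x₀
      (hasFDerivAt_ringInverse (𝕜 := ℝ) (g j : Aˣ))
      (HasFDerivAt.comp (g := fun y : Fin (p + 1) → A => y j) (f := Prod.snd) x₀
        (hasFDerivAt_apply (𝕜 := ℝ) (F' := fun _ => A) j _) hasFDerivAt_snd)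
  constructor
  · have h3 := differentiableAt_ofSubsingleton_sum (fun j x => bary x.1 j)
      (fun j x => Ring.inverse (x.2 j)) (fun j => (ContinuousLinearMap.proj j).comp
        (ContinuousLinearMap.snd ℝ (Fin p → ℝ) (Fin (p + 1) → A))) x₀
      (fun j => (h1 j).differentiableAt) (fun j => (h2 j).differentiableAt)
    exact h3
  · intro u w
    have h3 := HasFDerivAt.fun_sum (u := Finset.univ) fun j _ =>
      (h1 j).fun_smul ((h2 j).mul_const' ((w 0).2 j))
    have e : (fun x => ambientConnection A p x w) = fun x => ∑ j,
        bary x.1 j • (Ring.inverse (x.2 j) * (w 0).2 j) := by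
      funext x
      simp [ambientConnection]
    rw [e, h3.fderiv]
    simp [hD', el, mul_assoc, sub_eq_neg_add, hx₀]

/-- The exterior derivative of the canonical connection takes values in the Lie algebra. -/
theorem extDeriv_ambientConnection_mem {p : ℕ} (t : Fin p → ℝ) (g : Fin (p + 1) → G)
    (v : Fin 2 → TanE G g) :
    extDeriv (ambientConnection A p) (t, fun j => el (g j)) (fun i => inclE G g (v i)) ∈
      (lieAlg G).toSubmodule := by
  obtain ⟨h1, h2⟩ := differentiableAt_ambientConnection G t g
  have hm : ∀ i j, el (g j)⁻¹ * (v i).2 j ∈ (lieAlg G).toSubmodule := fun i j =>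
    (maurerCartanLeft (g j) ((v i).2 j)).2
  have e : extDeriv (ambientConnection A p) (t, fun j => el (g j)) (fun i => inclE G g (v i)) =
      ∑ j, (dbary (v 0).1 j • (el (g j)⁻¹ * (v 1).2 j) -
        dbary (v 1).1 j • (el (g j)⁻¹ * (v 0).2 j) -
        bary t j • ⁅el (g j)⁻¹ * ((v 0).2 j : A), el (g j)⁻¹ * ((v 1).2 j : A)⁆) := by
    rw [extDeriv_apply h1]
    simp only [h2]
    rw [← sub_eq_zero]
    simp [inclE, Ring.lie_def, Fin.removeNth, ← Finset.sum_sub_distrib, ← Finset.sum_neg_distrib,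
      ← Finset.sum_add_distrib, smul_sub]
    exact Finset.sum_eq_zero fun j _ => by abel
  rw [e]
  refine Submodule.sum_mem _ fun j _ => ?_
  exact Submodule.sub_mem _ (Submodule.sub_mem _ (Submodule.smul_mem _ _ (hm 1 j))
    (Submodule.smul_mem _ _ (hm 0 j)))
    (Submodule.smul_mem _ _ ((lieAlg G).lie_mem (hm 0 j) (hm 1 j)))

/-- The curvature `κ = dω + 1/2 [ω ∧ ω]` of the canonical connection `ω`. The first term is the
restriction to `Δ^p × EG_p` of the exterior derivative of an extension of `ω`. -/
def curvature {p : ℕ} (t : Fin p → ℝ) (g : Fin (p + 1) → G) : TanE G g [⋀^Fin 2]→ₗ[ℝ] lieAlg G :=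
  ((extDeriv (ambientConnection A p) (t, fun j => el (g j))).toAlternatingMap.compLinearMap
      (inclE G g)).codRestrict (lieAlg G).toSubmodule (extDeriv_ambientConnection_mem G t g) +
    (1 / 2 : ℝ) • wedge (j := 1) (k := 1) (bracket G) (connection G t g) (connection G t g)

/-- The `q`-form on `EG_p` obtained from the `4`-form `f(κ ∧ κ)` on `Δ^p × EG_p`, `p + q = 4`, by
integration over the fibre `Δ^p`:
`χ(f)(u_1, …, u_q) = ∫_{Δ^p} f(κ ∧ κ)(∂/∂t_1, …, ∂/∂t_p, u_1, …, u_q) dt_1 ⋯ dt_p`. -/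
def chi (f : LinearMap.BilinForm ℝ (lieAlg G)) {p q : ℕ} (h : p + q = 4) (g : Fin (p + 1) → G)
    (u : Fin q → Tan G g) : ℝ :=
  ∫ t in simplex p, wedge (j := 2) (k := 2) f (curvature G t g) (curvature G t g) fun i =>
    Fin.append (fun a : Fin p => ((Pi.single a 1, 0) : TanE G g)) (fun b => (0, u b))
      (Fin.cast h.symm i)

/-- The map `γ : EG_p = G^{p+1} → BG_p = G^p`,
`(g_0, …, g_p) ↦ (g_1 g_0⁻¹, …, g_p g_{p-1}⁻¹)`. -/
def gam {p : ℕ} (g : Fin (p + 1) → G) : Fin p → G := fun i => g i.succ * (g i.castSucc)⁻¹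

/-- The differential of `γ` at `g`; see `hasDerivAt_el_div`. -/
def dGam {p : ℕ} (g : Fin (p + 1) → G) : Tan G g →ₗ[ℝ] Tan G (gam G g) :=
  LinearMap.pi fun i =>
    LinearMap.codRestrict (tangentAt G (gam G g i))
      ((LinearMap.mulRight ℝ (el (g i.castSucc)⁻¹)).comp
          ((tangentAt G (g i.succ)).subtype.comp (LinearMap.proj i.succ)) -
        (LinearMap.mulLeft ℝ (el (gam G g i))).comp
          ((LinearMap.mulRight ℝ (el (g i.castSucc)⁻¹)).comp
            ((tangentAt G (g i.castSucc)).subtype.comp (LinearMap.proj i.castSucc))))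
      (fun X => IsVelocity.div (X i.succ).2 (X i.castSucc).2)

/-- `Φ` represents on `BG_•` the class of the invariant symmetric bilinear form `f`: its pullback
along `γ : EG_• → BG_•` is `χ(f)`. -/
def IsShulmanRep (f : LinearMap.BilinForm ℝ (lieAlg G)) (Φ : Tot G 4) : Prop :=
  ∀ (p q : ℕ) (h : p + q = 4) (g : Fin (p + 1) → G) (u : Fin q → Tan G g),
    Φ ⟨(p, q), h⟩ (gam G g) (fun b => dGam G g (u b)) = chi G f h g u

end Classifying

section Pontryagin

open Matrix

theorem sum_powersetCard_two {α : Type*} [DecidableEq α] (D : Finset α → ℝ) (F : α → α → ℝ)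
    (hD : ∀ a b, a ≠ b → D {a, b} = F a b) (h0 : ∀ a, F a a = 0) (hs : ∀ a b, F a b = F b a)
    (T : Finset α) : 2 * ∑ s ∈ T.powersetCard 2, D s = ∑ i ∈ T, ∑ j ∈ T, F i j := by
  induction T using Finset.induction_on with
  | empty =>
    rw [Finset.powersetCard_eq_empty.2 (by simp)]
    simp
  | insert a T ha ih =>
    have hT : ∀ j ∈ T, a ≠ j := fun j hj h => ha (h ▸ hj)
    rw [Finset.powersetCard_succ_insert ha, Finset.sum_union, Finset.sum_image, mul_add, ih,
      Finset.sum_insert ha, Finset.sum_insert ha, Finset.powersetCard_one, Finset.sum_map,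
      Finset.sum_congr rfl fun i hi => Finset.sum_insert (f := F i) ha, Finset.sum_add_distrib,
      h0, Finset.sum_congr rfl fun i hi => hs i a]
    · have e : ∑ x ∈ T, D (insert a ((⟨singleton, Finset.singleton_injective⟩ : α ↪ Finset α) x)) =
          ∑ x ∈ T, F a x := Finset.sum_congr rfl fun i hi => hD a i (hT i hi)
      rw [e]
      ring
    · intro s hs t ht h
      have has : ∀ u ∈ T.powersetCard 1, a ∉ u := fun u hu hau =>
        ha ((Finset.mem_powersetCard.1 hu).1 hau)
      rw [← Finset.erase_insert (has s hs), h, Finset.erase_insert (has t ht)]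
    · rw [Finset.disjoint_left]
      intro s hs hs'
      obtain ⟨t, -, rfl⟩ := Finset.mem_image.1 hs'
      exact ha ((Finset.mem_powersetCard.1 hs).1 (Finset.mem_insert_self _ _))

theorem det_submatrix_pair {n : ℕ} (X : Matrix (Fin n) (Fin n) ℝ) {a b : Fin n} (h : a ≠ b) :
    (X.submatrix (Subtype.val : ({a, b} : Finset (Fin n)) → Fin n) Subtype.val).det =
      X a a * X b b - X a b * X b a := by
  let e : Fin 2 ≃ ({a, b} : Finset (Fin n)) := Equiv.ofBijective
    ![⟨a, by simp⟩, ⟨b, by simp⟩] (by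
      constructor
      · intro i j hij
        fin_cases i <;> fin_cases j <;> simp_all
      · rintro ⟨x, hx⟩
        rcases Finset.mem_insert.1 hx with rfl | hx
        · exact ⟨0, rfl⟩
        · obtain rfl := Finset.mem_singleton.1 hx
          exact ⟨1, rfl⟩)
  rw [← Matrix.det_submatrix_equiv_self e, Matrix.det_fin_two]
  rfl

/-- The Pontryagin polynomial `P_{k/2}`: the coefficient of `t^{n-k}` in `det(t - A/2π)`. -/
def pontryaginPoly (n k : ℕ) (X : Matrix (Fin n) (Fin n) ℝ) : ℝ :=
  if k ≤ n then (charpoly ((2 * Real.pi)⁻¹ • X)).coeff (n - k) else 0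

theorem pontryaginPoly_two (n : ℕ) (X : Matrix (Fin n) (Fin n) ℝ) :
    pontryaginPoly n 2 X = 1 / (8 * Real.pi ^ 2) * (X.trace ^ 2 - (X * X).trace) := by
  have key : ∀ Y : Matrix (Fin n) (Fin n) ℝ, 2 * ∑ s ∈ Finset.univ.powersetCard 2,
      (Y.submatrix (Subtype.val : {x // x ∈ s} → Fin n) Subtype.val).det =
      Y.trace ^ 2 - (Y * Y).trace := fun Y => by
    have h := sum_powersetCard_two (fun s : Finset (Fin n) =>
      (Y.submatrix (Subtype.val : {x // x ∈ s} → Fin n) Subtype.val).det)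
      (fun a b => Y a a * Y b b - Y a b * Y b a)
      (fun a b h => det_submatrix_pair Y h) (fun a => by ring) (fun a b => by ring) Finset.univ
    rw [h]
    simp [Matrix.trace, Matrix.mul_apply, sq, Finset.sum_mul_sum]
  have h2 : 2 * pontryaginPoly n 2 X = ((2 * Real.pi)⁻¹ • X).trace ^ 2 -
      (((2 * Real.pi)⁻¹ • X) * ((2 * Real.pi)⁻¹ • X)).trace := by
    rw [← key, pontryaginPoly]
    split_ifs with h
    · have := charpoly_coeff_eq_sum_minors ((2 * Real.pi)⁻¹ • X) 2 (by simpa using h)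
      rw [Fintype.card_fin] at this
      rw [this]
      norm_num
    · rw [Finset.powersetCard_eq_empty.2 (by simpa using h)]
      simp
  have h3 : pontryaginPoly n 2 X = 1 / 2 * (2 * pontryaginPoly n 2 X) := by ring
  rw [h3, h2]
  simp
  ring

/-- The symmetric bilinear form with `p_1(X, X) = pontryaginPoly n 2 X`. -/
def pontryaginOne (n : ℕ) : LinearMap.BilinForm ℝ (Matrix (Fin n) (Fin n) ℝ) :=
  LinearMap.mk₂ ℝ (fun X Y => (1 / 2 : ℝ) *
      (pontryaginPoly n 2 (X + Y) - pontryaginPoly n 2 X - pontryaginPoly n 2 Y))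
    (fun X X' Y => by simp [pontryaginPoly_two, add_mul, mul_add, trace_mul_comm X Y,
      trace_mul_comm X' Y]; ring)
    (fun a X Y => by simp [pontryaginPoly_two, add_mul, mul_add, trace_mul_comm X Y]; ring)
    (fun X Y Y' => by simp [pontryaginPoly_two, add_mul, mul_add, trace_mul_comm X Y,
      trace_mul_comm X Y']; ring)
    (fun a X Y => by simp [pontryaginPoly_two, add_mul, mul_add, trace_mul_comm X Y]; ring)

end Pontryagin

section Groups

/-- The orthogonal group `O(n)`. -/
abbrev orthGroup (n : ℕ) : Subgroup (Matrix (Fin n) (Fin n) ℝ)ˣ :=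
  (Matrix.orthogonalGroup (Fin n) ℝ).units

/-- The special orthogonal group `SO(n)`. -/
abbrev specialOrthGroup (n : ℕ) : Subgroup (Matrix (Fin n) (Fin n) ℝ)ˣ :=
  (Matrix.specialOrthogonalGroup (Fin n) ℝ).units

/-- The quadratic form `v ↦ -|v|²` on `ℝⁿ`. -/
abbrev cliffForm (n : ℕ) : QuadraticForm ℝ (Fin n → ℝ) :=
  QuadraticMap.weightedSumSquares ℝ (fun _ : Fin n => (-1 : ℝ))

/-- The Clifford algebra of `ℝⁿ` with `v² = -|v|²`. -/
abbrev Cliff (n : ℕ) : Type := CliffordAlgebra (cliffForm n)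

instance finite_exteriorAlgebra (n : ℕ) : Module.Finite ℝ (ExteriorAlgebra ℝ (Fin n → ℝ)) := by
  have h1 : ∀ k : ℕ, n < k → ⋀[ℝ]^k (Fin n → ℝ) = ⊥ := fun k hk => by
    have h := exteriorPower.finrank_eq ℝ (M := Fin n → ℝ) k
    rw [Module.finrank_fin_fun, Nat.choose_eq_zero_of_lt hk] at h
    exact Submodule.finrank_eq_zero.1 h
  have h2 : (⨆ k : ℕ, ⋀[ℝ]^k (Fin n → ℝ)) = ⊤ :=
    (DirectSum.Decomposition.isInternal fun k : ℕ => ⋀[ℝ]^k (Fin n → ℝ)).submodule_iSup_eq_top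
  have h3 : (⨆ k ∈ Finset.range (n + 1), ⋀[ℝ]^k (Fin n → ℝ)) = ⊤ := by
    rw [eq_top_iff, ← h2]
    refine iSup_le fun k => ?_
    by_cases hk : k < n + 1
    · exact le_iSup₂_of_le k (Finset.mem_range.2 hk) le_rfl
    · rw [h1 k (by omega)]
      exact bot_le
  refine ⟨?_⟩
  rw [← h3]
  exact Submodule.fg_biSup _ _ fun k _ => Module.Finite.iff_fg.1 inferInstance

instance finite_cliff (n : ℕ) : Module.Finite ℝ (Cliff n) :=
  Module.Finite.equiv (CliffordAlgebra.equivExterior (cliffForm n)).symm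

/-- An auxiliary faithful matrix representation of the Clifford algebra. It only serves to
choose a norm on this finite-dimensional algebra; smoothness and derivatives of curves do not
depend on that choice. -/
def cliffMatrix (n : ℕ) :=
  Algebra.leftMulMatrix (Module.finBasis ℝ (Cliff n))

theorem cliffMatrix_injective (n : ℕ) : Function.Injective (cliffMatrix n) :=
  Algebra.leftMulMatrix_injective _

instance normedRing_cliff (n : ℕ) : NormedRing (Cliff n) :=
  NormedRing.induced _ _ (cliffMatrix n) (cliffMatrix_injective n)

instance normedAlgebra_cliff (n : ℕ) : NormedAlgebra ℝ (Cliff n) :=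
  NormedAlgebra.induced ℝ _ _ (cliffMatrix n)


/-- The group `Spin(n)` of products of an even number of unit vectors of `ℝⁿ` in the Clifford
algebra. -/
abbrev spinGrp (n : ℕ) : Subgroup (Cliff n)ˣ := (spinGroup (cliffForm n)).units

/-- A linear left inverse of the inclusion `ℝⁿ → Cliff n`. -/
def cliffInv (n : ℕ) : Cliff n →ₗ[ℝ] (Fin n → ℝ) :=
  ExteriorAlgebra.ιInv.comp (CliffordAlgebra.equivExterior (cliffForm n)).toLinearMap

theorem cliffInv_ι (n : ℕ) (v : Fin n → ℝ) :
    cliffInv n (CliffordAlgebra.ι (cliffForm n) v) = v := by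
  simp [cliffInv, CliffordAlgebra.equivExterior, ExteriorAlgebra.ι_leftInverse v]

/-- The covering `π : Spin(n) → SO(n)`, `π(g) v = g v g⁻¹` for `v ∈ ℝⁿ`. -/
def spinCover (n : ℕ) (g : spinGrp n) : Matrix (Fin n) (Fin n) ℝ :=
  LinearMap.toMatrix' ((cliffInv n).comp
    ((LinearMap.mulLeftRight ℝ (el g, el g⁻¹)).comp (CliffordAlgebra.ι (cliffForm n))))

theorem ι_spinCover (n : ℕ) (g : spinGrp n) (v : Fin n → ℝ) :
    CliffordAlgebra.ι (cliffForm n) ((spinCover n g).mulVec v) =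
      el g * CliffordAlgebra.ι (cliffForm n) v * el g⁻¹ := by
  obtain ⟨w, hw⟩ := spinGroup.conjAct_smul_ι_mem_range_ι (x := (g : (Cliff n)ˣ)) g.2.1 v
  rw [ConjAct.units_smul_def, ConjAct.ofConjAct_toConjAct] at hw
  have h : (spinCover n g).mulVec v =
      cliffInv n (el g * CliffordAlgebra.ι (cliffForm n) v * el g⁻¹) := by
    rw [spinCover, ← Matrix.toLin'_apply, Matrix.toLin'_toMatrix']
    simp
  rw [h]
  have e : el g * CliffordAlgebra.ι (cliffForm n) v * el g⁻¹ = CliffordAlgebra.ι _ w := by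
    rw [hw]; simp [el]
  rw [e, cliffInv_ι]

attribute [local instance 10] LieRing.ofAssociativeRing

/-- The differential `spin(n) → so(n)` of the covering `π` at `1`: `X` acts on `ℝⁿ` by the
commutator `v ↦ X v - v X`. -/
def spinRep (n : ℕ) : lieAlg (spinGrp n) →ₗ[ℝ] Matrix (Fin n) (Fin n) ℝ where
  toFun X := LinearMap.toMatrix' ((cliffInv n).comp
    ((LinearMap.mulLeft ℝ (X : Cliff n) - LinearMap.mulRight ℝ (X : Cliff n)).comp
      (CliffordAlgebra.ι (cliffForm n))))
  map_add' X Y := by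
    rw [← map_add]
    congr 1
    refine LinearMap.ext fun v => ?_
    have e : ((X + Y : lieAlg (spinGrp n)) : Cliff n) = X + Y := rfl
    simp only [LinearMap.comp_apply, LinearMap.sub_apply, LinearMap.add_apply,
      LinearMap.mulLeft_apply, LinearMap.mulRight_apply, e, add_mul, mul_add,
      map_add, map_sub]
    abel
  map_smul' a X := by
    rw [RingHom.id_apply, ← map_smul]
    congr 1
    refine LinearMap.ext fun v => ?_
    simp [smul_sub]

theorem hasDerivAt_spinCover (n : ℕ) (c : ℝ → spinGrp n) (X : lieAlg (spinGrp n))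
    (hc0 : c 0 = 1) (hc : HasDerivAt (fun t => el (c t)) (X : Cliff n) 0) (v : Fin n → ℝ) :
    HasDerivAt (fun t => (spinCover n (c t)).mulVec v) ((spinRep n X).mulVec v) 0 := by
  have h1 := (hc.mul_const (CliffordAlgebra.ι (cliffForm n) v)).mul (hasDerivAt_el_inv hc)
  have h2 := (LinearMap.toContinuousLinearMap (cliffInv n)).hasFDerivAt.comp_hasDerivAt (0 : ℝ) h1
  refine (h2.congr_of_eventuallyEq (Filter.Eventually.of_forall fun t => ?_)).congr_deriv ?_
  · simp only [spinCover]
    rw [← Matrix.toLin'_apply, Matrix.toLin'_toMatrix']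
    simp
  · simp only [spinRep, LinearMap.coe_mk, AddHom.coe_mk]
    rw [← Matrix.toLin'_apply, Matrix.toLin'_toMatrix']
    simp [el, hc0, sub_eq_add_neg]

/-- The Killing form of the Lie algebra of `G`. -/
def killing {A : Type*} [NormedRing A] [NormedAlgebra ℝ A] [FiniteDimensional ℝ A]
    (G : Subgroup Aˣ) : LinearMap.BilinForm ℝ (lieAlg G) := killingForm ℝ (lieAlg G)

theorem killing_apply {A : Type*} [NormedRing A] [NormedAlgebra ℝ A] [FiniteDimensional ℝ A]
    (G : Subgroup Aˣ) (X Y : lieAlg G) :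
    killing G X Y = LinearMap.trace ℝ _ ((bracket G X).comp (bracket G Y)) := rfl

/-- The first Pontryagin form on the Lie algebra of `G`, for a representation `ρ` of it on `ℝⁿ`. -/
def pontryaginForm {A : Type*} [NormedRing A] [NormedAlgebra ℝ A] [FiniteDimensional ℝ A]
    (G : Subgroup Aˣ) {n : ℕ} (ρ : lieAlg G →ₗ[ℝ] Matrix (Fin n) (Fin n) ℝ) :
    LinearMap.BilinForm ℝ (lieAlg G) :=
  (pontryaginOne n).compl₁₂ ρ ρ

/-- The inclusion of the Lie algebra of a matrix group in the space of matrices. -/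
def matrixRep {n : ℕ} (G : Subgroup (Matrix (Fin n) (Fin n) ℝ)ˣ) :
    lieAlg G →ₗ[ℝ] Matrix (Fin n) (Fin n) ℝ :=
  (lieAlg G).toSubmodule.subtype

end Groups

end BGForms

end

noncomputable section

namespace BGForms

/-! ### Wedge products in low degree as explicit signed sums -/

section WedgeExpansions

/-! The argument separates a statement about any Ad-invariant symmetric bilinear form `f` on any of
these Lie algebras from the computation of one constant.

For the general statement, `isShulmanRep_symplecticForm`, the curvature of `∑ t_j ω_j` is written
out (`curvature_apply`). It vanishes on two simplex directions, and on `∂/∂t_a` paired with a group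
direction it is the difference `ω_a - ω_0`, independent of `t`. Hence `f(κ ∧ κ)` has no fibre
integral for `p = 3, 4`. For `p = 0` the connection is flat by the Maurer–Cartan equation. For `p =
1` the curvature on group directions is `-t(1-t)[δ, δ]` with `δ = ω_1 - ω_0`, and `∫ t(1-t) = 1/6`
produces the cubic term. For `p = 2` only the area `1/2` of the triangle enters. Along `γ` the
Maurer–Cartan forms of `BG_p` become these differences twisted by an adjoint action, which `f` does
not see; so `χ(f)` is the pullback of the symplectic form built from `f`.

Uniqueness, `IsShulmanRep.unique`, holds because `γ` and its differential are surjective, so that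
`γ^*` is injective on forms.

For the constant, skew matrices have trace zero, so `p_1(X, Y) = -tr(XY)/(8π²)`, while the Killing
form is `(n-2) tr(XY)` (`trace_ad_ad_of_skew`). The symplectic form is linear in the pairing, so the
ratio of the two forms is the factor claimed.

It remains to identify each Lie algebra with the skew matrices. For `O(n)` and `SO(n)` one
differentiates orthogonality and exponentiates. For `Spin(n)`, the differential of the covering is
injective because an even Clifford element commuting with all vectors is a scalar, and no nonzero
scalar is reversed to its negative; it is surjective because the products `e_i e_j` are velocities
of explicit curves. -/

theorem sum_perm_fin_succ {n : ℕ} {W : Type*} [AddCommGroup W]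
    (f : Equiv.Perm (Fin (n + 1)) → W) :
    ∑ σ, (Equiv.Perm.sign σ : ℤ) • f σ = ∑ p : Fin (n + 1), ∑ σ : Equiv.Perm (Fin n),
      (Equiv.Perm.sign σ : ℤ) • ((if p = 0 then 1 else -1 : ℤ) •
        f (Equiv.Perm.decomposeFin.symm (p, σ))) := by
  rw [← Fintype.sum_prod_type', ← Equiv.sum_comp Equiv.Perm.decomposeFin.symm]
  refine Finset.sum_congr rfl fun x _ => ?_
  rw [Equiv.Perm.decomposeFin.symm_sign, smul_smul]
  split_ifs <;> simp

theorem sum_perm_three {W : Type*} [AddCommGroup W] (b : Fin 3 → Fin 3 → Fin 3 → W) :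
    ∑ σ : Equiv.Perm (Fin 3), (Equiv.Perm.sign σ : ℤ) • b (σ 0) (σ 1) (σ 2) =
      b 0 1 2 - b 0 2 1 - b 1 0 2 + b 1 2 0 + b 2 0 1 - b 2 1 0 := by
  rw [sum_perm_fin_succ, Fin.sum_univ_three]
  simp only [sum_perm_fin_succ, ← Fin.succ_zero_eq_one,
    show (2 : Fin 3) = Fin.succ (Fin.succ 0) from rfl,
    Equiv.Perm.decomposeFin_symm_apply_succ, Equiv.Perm.decomposeFin_symm_apply_zero]
  simp [Equiv.swap_apply_def]
  abel

theorem sum_perm_four {W : Type*} [AddCommGroup W] (b : Fin 4 → Fin 4 → Fin 4 → Fin 4 → W) :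
    ∑ σ : Equiv.Perm (Fin 4), (Equiv.Perm.sign σ : ℤ) • b (σ 0) (σ 1) (σ 2) (σ 3) =
      (b 0 1 2 3 - b 0 1 3 2 - b 0 2 1 3 + b 0 2 3 1 + b 0 3 1 2 - b 0 3 2 1) -
      (b 1 0 2 3 - b 1 0 3 2 - b 1 2 0 3 + b 1 2 3 0 + b 1 3 0 2 - b 1 3 2 0) +
      (b 2 0 1 3 - b 2 0 3 1 - b 2 1 0 3 + b 2 1 3 0 + b 2 3 0 1 - b 2 3 1 0) -
      (b 3 0 1 2 - b 3 0 2 1 - b 3 1 0 2 + b 3 1 2 0 + b 3 2 0 1 - b 3 2 1 0) := by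
  have h : ∀ p : Fin 4, ∑ σ : Equiv.Perm (Fin 3), (Equiv.Perm.sign σ : ℤ) •
      ((if p = 0 then 1 else -1 : ℤ) • b p (Equiv.swap 0 p (σ 0).succ)
        (Equiv.swap 0 p (σ 1).succ) (Equiv.swap 0 p (σ 2).succ)) = _ := fun p =>
    sum_perm_three fun i j k => (if p = 0 then 1 else -1 : ℤ) • b p (Equiv.swap 0 p i.succ)
        (Equiv.swap 0 p j.succ) (Equiv.swap 0 p k.succ)
  rw [sum_perm_fin_succ]
  simp only [show (1 : Fin 4) = Fin.succ 0 from rfl,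
    show (2 : Fin 4) = Fin.succ 1 from rfl, show (3 : Fin 4) = Fin.succ 2 from rfl,
    Equiv.Perm.decomposeFin_symm_apply_succ, Equiv.Perm.decomposeFin_symm_apply_zero, h]
  simp [Fin.sum_univ_four, Equiv.swap_apply_def]
  abel

theorem eq_vec_one {M : Type*} (f : Fin 1 → M) : f = ![f 0] := by
  funext i; fin_cases i; rfl

theorem eq_vec_two {M : Type*} (f : Fin 2 → M) : f = ![f 0, f 1] := by
  funext i; fin_cases i <;> rfl

variable {M F F' F'' : Type*} [AddCommGroup M] [Module ℝ M] [AddCommGroup F] [Module ℝ F]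
  [AddCommGroup F'] [Module ℝ F'] [AddCommGroup F''] [Module ℝ F'']

theorem map_pair_swap (φ : M [⋀^Fin 2]→ₗ[ℝ] F) (x y : M) : φ ![y, x] = -φ ![x, y] := by
  have h := φ.map_swap ![x, y] (i := 0) (j := 1) (by decide)
  rw [← h]
  congr 1
  funext i
  fin_cases i <;> rfl

theorem wedge_one_one (B : F →ₗ[ℝ] F' →ₗ[ℝ] F'') (φ : M [⋀^Fin 1]→ₗ[ℝ] F)
    (ψ : M [⋀^Fin 1]→ₗ[ℝ] F') (v : Fin 2 → M) :
    wedge (j := 1) (k := 1) B φ ψ v =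
      B (φ ![v 0]) (ψ ![v 1]) - B (φ ![v 1]) (ψ ![v 0]) := by
  rw [wedge_apply]
  simp only [Nat.reduceAdd]
  simp_rw [fun (σ : Equiv.Perm (Fin 2)) => eq_vec_one (fun i : Fin 1 => v (σ (Fin.castAdd 1 i))),
    fun (σ : Equiv.Perm (Fin 2)) => eq_vec_one (fun i : Fin 1 => v (σ (Fin.natAdd 1 i)))]
  have h : (Finset.univ : Finset (Equiv.Perm (Fin 2))) = {1, Equiv.swap 0 1} := by decide
  have a0 : Fin.castAdd 1 (0 : Fin 1) = (0 : Fin 2) := rfl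
  rw [h, Finset.sum_pair (by decide)]
  simp [a0, sub_eq_add_neg]

theorem wedge_one_two (B : F →ₗ[ℝ] F' →ₗ[ℝ] F'') (φ : M [⋀^Fin 1]→ₗ[ℝ] F)
    (ψ : M [⋀^Fin 2]→ₗ[ℝ] F') (v : Fin 3 → M) :
    wedge (j := 1) (k := 2) B φ ψ v =
      B (φ ![v 0]) (ψ ![v 1, v 2]) - B (φ ![v 1]) (ψ ![v 0, v 2]) +
        B (φ ![v 2]) (ψ ![v 0, v 1]) := by
  rw [wedge_apply]
  simp only [Nat.reduceAdd]
  simp_rw [fun (σ : Equiv.Perm (Fin 3)) => eq_vec_one (fun i : Fin 1 => v (σ (Fin.castAdd 2 i))),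
    fun (σ : Equiv.Perm (Fin 3)) => eq_vec_two (fun i : Fin 2 => v (σ (Fin.natAdd 1 i)))]
  have h := sum_perm_three fun i j k => B (φ ![v i]) (ψ ![v j, v k])
  refine (congrArg _ h).trans ?_
  rw [map_pair_swap ψ (v 1) (v 2), map_pair_swap ψ (v 0) (v 2), map_pair_swap ψ (v 0) (v 1)]
  simp only [map_neg, Nat.factorial]
  norm_num
  module

/-- The 24 permutations fall into three splittings of the arguments into two pairs, 8 equal terms
each: order within each pair, and order of the pairs by symmetry of `B`. The normalization `1/4`
leaves the factor 2. -/
theorem wedge_two_two (B : F →ₗ[ℝ] F →ₗ[ℝ] F'') (hB : ∀ x y, B x y = B y x)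
    (φ : M [⋀^Fin 2]→ₗ[ℝ] F) (v : Fin 4 → M) :
    wedge (j := 2) (k := 2) B φ φ v =
      (2 : ℝ) • (B (φ ![v 0, v 1]) (φ ![v 2, v 3]) - B (φ ![v 0, v 2]) (φ ![v 1, v 3]) +
        B (φ ![v 0, v 3]) (φ ![v 1, v 2])) := by
  rw [wedge_apply]
  simp only [Nat.reduceAdd]
  simp_rw [fun (σ : Equiv.Perm (Fin 4)) => eq_vec_two (fun i : Fin 2 => v (σ (Fin.castAdd 2 i))),
    fun (σ : Equiv.Perm (Fin 4)) => eq_vec_two (fun i : Fin 2 => v (σ (Fin.natAdd 2 i)))]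
  have h := sum_perm_four fun i j k l => B (φ ![v i, v j]) (φ ![v k, v l])
  refine (congrArg _ h).trans ?_
  rw [map_pair_swap φ (v 0) (v 1), map_pair_swap φ (v 0) (v 2), map_pair_swap φ (v 0) (v 3),
    map_pair_swap φ (v 1) (v 2), map_pair_swap φ (v 1) (v 3), map_pair_swap φ (v 2) (v 3)]
  simp only [map_neg, LinearMap.neg_apply, Nat.factorial]
  rw [hB (φ ![v 2, v 3]), hB (φ ![v 1, v 3]), hB (φ ![v 1, v 2])]
  norm_num
  module

end WedgeExpansions

/-! ### Curvature of the canonical connection, and the map `γ` -/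

section CharacteristicForms

variable {A : Type*} [NormedRing A] [NormedAlgebra ℝ A] [FiniteDimensional ℝ A]

attribute [local instance 10] LieRing.ofAssociativeRing

variable (G : Subgroup Aˣ)

theorem connection_apply {p : ℕ} (t : Fin p → ℝ) (g : Fin (p + 1) → G) (v : Fin 1 → TanE G g) :
    connection G t g v = ∑ j, bary t j • maurerCartanLeft (g j) ((v 0).2 j) := by
  simp [connection]

/-- The `dbary` terms are `dt_j ∧ ω_j`; the terms weighted by `bary t j` are the Maurer–Cartan
equation `dω_j = -½[ω_j ∧ ω_j]`, from differentiating the inverse. The last bracket is `½[ω ∧ ω]`.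
-/
theorem curvature_apply {p : ℕ} (t : Fin p → ℝ) (g : Fin (p + 1) → G) (v w : TanE G g) :
    curvature G t g ![v, w] =
      ∑ j, (dbary v.1 j • maurerCartanLeft (g j) (w.2 j) -
        dbary w.1 j • maurerCartanLeft (g j) (v.2 j) -
        bary t j • ⁅maurerCartanLeft (g j) (v.2 j), maurerCartanLeft (g j) (w.2 j)⁆) +
      ⁅∑ j, bary t j • maurerCartanLeft (g j) (v.2 j),
        ∑ j, bary t j • maurerCartanLeft (g j) (w.2 j)⁆ := by
  obtain ⟨h1, h2⟩ := differentiableAt_ambientConnection G t g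
  unfold curvature
  rw [AlternatingMap.add_apply, AlternatingMap.smul_apply, wedge_one_one]
  congr 1
  · refine Subtype.ext ?_
    change extDeriv (ambientConnection A p) (t, fun j => el (g j))
      (fun i => inclE G g (![v, w] i)) = _
    rw [extDeriv_apply h1]
    simp only [h2]
    rw [← sub_eq_zero]
    simp [inclE, Ring.lie_def, Fin.removeNth, ← Finset.sum_sub_distrib, ← Finset.sum_neg_distrib,
      ← Finset.sum_add_distrib, smul_sub, coe_maurerCartanLeft]
    exact Finset.sum_eq_zero fun j _ => by abel
  · simp only [connection_apply, bracket, Matrix.cons_val_zero, Matrix.cons_val_one,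
      LieHom.coe_toLinearMap, LieAlgebra.ad_apply]
    rw [← lie_skew (∑ j, bary t j • maurerCartanLeft (g j) (v.2 j))]
    module

theorem curvature_simplexVector {p : ℕ} (t : Fin p → ℝ) (g : Fin (p + 1) → G) (a b : Fin p) :
    curvature G t g ![(Pi.single a 1, 0), (Pi.single b 1, 0)] = 0 := by
  rw [curvature_apply]
  simp

theorem curvature_mixed {p : ℕ} (t : Fin p → ℝ) (g : Fin (p + 1) → G) (a : Fin p)
    (u : Tan G g) :
    curvature G t g ![(Pi.single a 1, 0), (0, u)] =
      maurerCartanLeft (g a.succ) (u a.succ) - maurerCartanLeft (g 0) (u 0) := by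
  rw [curvature_apply]
  simp [Fin.sum_univ_succ, dbary, Pi.single_apply, sub_eq_neg_add]

theorem curvature_zero (t : Fin 0 → ℝ) (g : Fin 1 → G) (v w : TanE G g) :
    curvature G t g ![v, w] = 0 := by
  rw [curvature_apply]
  simp [dbary, bary]
  rw [← lie_skew, neg_add_cancel]

/-- With weights `1 - t` and `t`, the bracket of the averages minus the average of the brackets is a
covariance, hence depends only on the differences. -/
theorem curvature_one (t : Fin 1 → ℝ) (g : Fin 2 → G) (u w : Tan G g) :
    curvature G t g ![(0, u), (0, w)] = -(t 0 * (1 - t 0)) •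
      ⁅maurerCartanLeft (g 1) (u 1) - maurerCartanLeft (g 0) (u 0),
        maurerCartanLeft (g 1) (w 1) - maurerCartanLeft (g 0) (w 0)⁆ := by
  rw [curvature_apply]
  have b0 : bary t 0 = 1 - t 0 := by simp [bary]
  have b1 : bary t 1 = t 0 := by
    rw [← Fin.succ_zero_eq_one, bary, Fin.cons_succ]
  have d0 : ∀ j, dbary (0 : Fin 1 → ℝ) j = 0 := fun j => by
    refine Fin.cases ?_ (fun i => ?_) j <;> simp [dbary]
  simp [Fin.sum_univ_succ, d0, b0, b1]
  module

/-- The adjoint action of `g` on the Lie algebra. -/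
def adjoint (g : G) : lieAlg G ≃ₗ⁅ℝ⁆ lieAlg G where
  toFun X := ⟨el g * X * el g⁻¹, by
    have h := IsVelocity.mul_right (IsVelocity.mul_left X.2 g) g⁻¹
    have e : g * 1 * g⁻¹ = 1 := by group
    rw [e] at h
    exact h⟩
  invFun X := ⟨el g⁻¹ * X * el g, by
    have h := IsVelocity.mul_right (IsVelocity.mul_left X.2 g⁻¹) g
    have e : g⁻¹ * 1 * g = 1 := by group
    rw [e] at h
    exact h⟩
  map_add' X Y := Subtype.ext (by simp [mul_add, add_mul])
  map_smul' a X := Subtype.ext (by simp)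
  map_lie' {X Y} := Subtype.ext (by
    simp [Ring.lie_def, mul_sub, sub_mul, mul_assoc, el])
  left_inv X := Subtype.ext (by simp [mul_assoc, el])
  right_inv X := Subtype.ext (by simp [mul_assoc, el])

theorem maurerCartanLeft_dGam {p : ℕ} (g : Fin (p + 1) → G) (u : Tan G g) (i : Fin p) :
    maurerCartanLeft (gam G g i) (dGam G g u i) = adjoint G (g i.castSucc)
      (maurerCartanLeft (g i.succ) (u i.succ) - maurerCartanLeft (g i.castSucc) (u i.castSucc)) := by
  refine Subtype.ext ?_
  change el (gam G g i)⁻¹ * (u i.succ * el (g i.castSucc)⁻¹ -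
      el (gam G g i) * (u i.castSucc * el (g i.castSucc)⁻¹)) =
    el (g i.castSucc) * (el (g i.succ)⁻¹ * u i.succ - el (g i.castSucc)⁻¹ * u i.castSucc) *
      el (g i.castSucc)⁻¹
  simp [gam, el, mul_sub, sub_mul, mul_assoc]

theorem maurerCartanRight_dGam {p : ℕ} (g : Fin (p + 1) → G) (u : Tan G g) (i : Fin p) :
    maurerCartanRight (gam G g i) (dGam G g u i) = adjoint G (g i.succ)
      (maurerCartanLeft (g i.succ) (u i.succ) - maurerCartanLeft (g i.castSucc) (u i.castSucc)) := by
  refine Subtype.ext ?_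
  change (u i.succ * el (g i.castSucc)⁻¹ -
      el (gam G g i) * (u i.castSucc * el (g i.castSucc)⁻¹)) * el (gam G g i)⁻¹ =
    el (g i.succ) * (el (g i.succ)⁻¹ * u i.succ - el (g i.castSucc)⁻¹ * u i.castSucc) *
      el (g i.succ)⁻¹
  simp [gam, el, mul_sub, sub_mul, mul_assoc]

theorem exists_gam_eq {A : Type*} [NormedRing A] {G : Subgroup Aˣ} {p : ℕ} (h : Fin p → G) : ∃ g : Fin (p + 1) → G, gam G g = h := by
  -- Start from `g_0 = 1` and solve `g_{i+1} = h_i g_i`.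
  refine ⟨fun i => Fin.induction (motive := fun _ => G) 1 (fun i x => h i * x) i, ?_⟩
  funext i
  simp [gam]

theorem dGam_surjective {p : ℕ} (g : Fin (p + 1) → G) : Function.Surjective (dGam G g) := by
  intro X
  -- The linearized recursion: differentiating `g_{i+1} = h_i g_i` expresses the next tangent vector
  -- through `X i` and the previous one `y`.
  have hX : ∀ (i : Fin p) (y : tangentAt G (g i.castSucc)),
      (X i : A) * el (g i.castSucc) + el (gam G g i) * y ∈ tangentAt G (g i.succ) := by
    intro i y
    have e : gam G g i * g i.castSucc = g i.succ := by simp [gam]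
    have h1 := IsVelocity.mul_right (X i).2 (g i.castSucc)
    have h2 := IsVelocity.mul_left y.2 (gam G g i)
    rw [e] at h1 h2
    exact h1.add h2
  refine ⟨fun i => Fin.induction (motive := fun i => tangentAt G (g i)) 0
    (fun i y => ⟨_, hX i y⟩) i, ?_⟩
  funext i
  refine Subtype.ext ?_
  simp [dGam, add_mul, mul_assoc, el]

theorem IsShulmanRep.unique {f : LinearMap.BilinForm ℝ (lieAlg G)} {Φ Φ' : Tot G 4}
    (h : IsShulmanRep G f Φ) (h' : IsShulmanRep G f Φ') : Φ = Φ' := by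
  funext ⟨⟨p, q⟩, hpq⟩ k
  obtain ⟨g, rfl⟩ := exists_gam_eq k
  refine AlternatingMap.ext fun v => ?_
  choose u hu using fun b => dGam_surjective G g (v b)
  obtain rfl : (fun b => dGam G g (u b)) = v := funext hu
  exact (h p q hpq g u).trans (h' p q hpq g u).symm

end CharacteristicForms

/-! ### The two integrals over simplices -/

section FibreIntegrals

open MeasureTheory

theorem volume_simplex_two : volume.real (simplex 2) = 1 / 2 := by
  have h := (volume_preserving_finTwoArrow ℝ).symm
  -- The triangle is cut into vertical slices of length `1 - x`, ready for Fubini.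
  have e : (MeasurableEquiv.finTwoArrow (α := ℝ)).symm ⁻¹' simplex 2 =
      {x : ℝ × ℝ | x.1 ∈ Set.Icc 0 1 ∧ x.2 ∈ Set.Icc 0 (1 - x.1)} := by
    ext ⟨x, y⟩
    simp [simplex, Fin.sum_univ_two]
    constructor
    · rintro ⟨⟨h0, h1⟩, h2⟩
      exact ⟨⟨h0, by linarith⟩, h1, by linarith⟩
    · rintro ⟨⟨h0, h1⟩, h2, h3⟩
      exact ⟨⟨h0, h2⟩, by linarith⟩
  have hm : MeasurableSet {x : ℝ × ℝ | x.1 ∈ Set.Icc 0 1 ∧ x.2 ∈ Set.Icc 0 (1 - x.1)} := by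
    refine (measurable_fst measurableSet_Icc).inter ?_
    refine MeasurableSet.inter (measurableSet_le measurable_const measurable_snd)
      (measurableSet_le measurable_snd (measurable_const.sub measurable_fst))
  have hx : ∀ x : ℝ, volume (Prod.mk x ⁻¹'
      {x : ℝ × ℝ | x.1 ∈ Set.Icc 0 1 ∧ x.2 ∈ Set.Icc 0 (1 - x.1)}) =
      (Set.Icc (0 : ℝ) 1).indicator (fun x => ENNReal.ofReal (1 - x)) x := by
    intro x
    by_cases hx : x ∈ Set.Icc (0 : ℝ) 1
    · have : Prod.mk x ⁻¹' {x : ℝ × ℝ | x.1 ∈ Set.Icc 0 1 ∧ x.2 ∈ Set.Icc 0 (1 - x.1)} =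
          Set.Icc 0 (1 - x) := by
        ext y
        exact and_iff_right hx
      rw [this, Set.indicator_of_mem hx, Real.volume_Icc, sub_zero]
    · have : Prod.mk x ⁻¹' {x : ℝ × ℝ | x.1 ∈ Set.Icc 0 1 ∧ x.2 ∈ Set.Icc 0 (1 - x.1)} = ∅ :=
        Set.eq_empty_of_forall_notMem fun y hy => hx hy.1
      rw [this, Set.indicator_of_notMem hx, measure_empty]
  rw [measureReal_def, ← h.measure_preimage_equiv, e, Measure.volume_eq_prod,
    Measure.prod_apply hm]
  simp only [hx]
  have hc : Continuous fun x : ℝ => 1 - x := by fun_prop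
  rw [lintegral_indicator measurableSet_Icc, ← ofReal_integral_eq_lintegral_ofReal
    (hc.continuousOn.integrableOn_compact isCompact_Icc)
    ((ae_restrict_iff' measurableSet_Icc).2 (Filter.Eventually.of_forall fun x hx =>
      sub_nonneg.2 hx.2)),
    integral_Icc_eq_integral_Ioc, ← intervalIntegral.integral_of_le zero_le_one,
    intervalIntegral.integral_sub (continuous_const.intervalIntegrable _ _)
      (continuous_id'.intervalIntegrable _ _)]
  norm_num [ENNReal.toReal_ofReal]

theorem integral_simplex_one : ∫ t in simplex 1, t 0 * (1 - t 0) = 1 / 6 := by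
  have e : simplex 1 = (MeasurableEquiv.funUnique (Fin 1) ℝ) ⁻¹' Set.Icc 0 1 := by
    ext t
    simp [simplex]
  rw [e]
  refine ((volume_preserving_funUnique (Fin 1) ℝ).setIntegral_preimage_emb
    (MeasurableEquiv.measurableEmbedding _) (fun x => x * (1 - x)) _).trans ?_
  rw [integral_Icc_eq_integral_Ioc, ← intervalIntegral.integral_of_le zero_le_one]
  simp only [mul_sub, mul_one]
  have hc : Continuous fun x : ℝ => x * x := by fun_prop
  rw [intervalIntegral.integral_sub (continuous_id'.intervalIntegrable _ _)
    (hc.intervalIntegrable _ _)]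
  simp [← sq]
  norm_num

end FibreIntegrals

/-! ### The fibre integrals, degree by degree -/

section CharacteristicForms

open MeasureTheory

variable {A : Type*} [NormedRing A] [NormedAlgebra ℝ A] [FiniteDimensional ℝ A]

attribute [local instance 10] LieRing.ofAssociativeRing

variable {G : Subgroup Aˣ} {f : LinearMap.BilinForm ℝ (lieAlg G)}

/-- The list `w` replaces the cast of `Fin.append`, so that for each concrete `p` the four arguments
can be read off definitionally. -/
theorem chi_eq_integral (hs : ∀ x y, f x y = f y x) {p q : ℕ} (h : p + q = 4)
    (g : Fin (p + 1) → G) (u : Fin q → Tan G g) (w : Fin 4 → TanE G g)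
    (hw : ∀ i, Fin.append (fun a : Fin p => ((Pi.single a 1, 0) : TanE G g))
      (fun b => (0, u b)) (Fin.cast h.symm i) = w i) :
    chi G f h g u = ∫ t in simplex p, 2 *
      (f (curvature G t g ![w 0, w 1]) (curvature G t g ![w 2, w 3]) -
        f (curvature G t g ![w 0, w 2]) (curvature G t g ![w 1, w 3]) +
        f (curvature G t g ![w 0, w 3]) (curvature G t g ![w 1, w 2])) := by
  unfold chi
  simp only [hw, wedge_two_two f hs, smul_eq_mul]

theorem chi_zero (hs : ∀ x y, f x y = f y x) (g : Fin 1 → G) (u : Fin 4 → Tan G g) :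
    chi G f (zero_add 4) g u = 0 := by
  rw [chi_eq_integral hs (zero_add 4) g u (fun i => (0, u i))
    (fun i => by fin_cases i <;> rfl)]
  simp [curvature_zero]

theorem chi_one (hs : ∀ x y, f x y = f y x) (g : Fin 2 → G) (u : Fin 3 → Tan G g)
    (δ : Fin 3 → lieAlg G)
    (hδ : ∀ b, δ b = maurerCartanLeft (g 1) (u b 1) - maurerCartanLeft (g 0) (u b 0)) :
    chi G f (show 1 + 3 = 4 from rfl) g u =
      -2 * (1 / 6) * (f (δ 0) ⁅δ 1, δ 2⁆ - f (δ 1) ⁅δ 0, δ 2⁆ + f (δ 2) ⁅δ 0, δ 1⁆) := by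
  rw [chi_eq_integral hs (show 1 + 3 = 4 from rfl) g u
    ![(Pi.single 0 1, 0), (0, u 0), (0, u 1), (0, u 2)]
    (fun i => by fin_cases i <;> rfl)]
  have e : ∀ t : Fin 1 → ℝ, ∀ b, curvature G t g ![(Pi.single 0 1, 0), (0, u b)] = δ b :=
    fun t b => by rw [curvature_mixed, hδ]; rfl
  simp only [Fin.isValue, Matrix.cons_val, e, curvature_one, ← hδ, map_smul, smul_eq_mul]
  rw [← integral_simplex_one, mul_assoc, ← integral_mul_const, ← integral_const_mul]
  congr 1
  funext t
  ring

/-- The integrand is constant. Its factor 2 cancels the area `1/2`, and since `∂/∂t_2` yields `ω_2 -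
ω_0 = ε + δ`, the terms in `δ` alone cancel by symmetry of `f`. -/
theorem chi_two (hs : ∀ x y, f x y = f y x) (g : Fin 3 → G) (u : Fin 2 → Tan G g)
    (δ ε : Fin 2 → lieAlg G)
    (hδ : ∀ b, δ b = maurerCartanLeft (g 1) (u b 1) - maurerCartanLeft (g 0) (u b 0))
    (hε : ∀ b, ε b = maurerCartanLeft (g 2) (u b 2) - maurerCartanLeft (g 1) (u b 1)) :
    chi G f (show 2 + 2 = 4 from rfl) g u = f (ε 0) (δ 1) - f (ε 1) (δ 0) := by
  rw [chi_eq_integral hs (show 2 + 2 = 4 from rfl) g u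
    ![(Pi.single 0 1, 0), (Pi.single 1 1, 0), (0, u 0), (0, u 1)]
    (fun i => by fin_cases i <;> rfl)]
  have e : ∀ t : Fin 2 → ℝ, ∀ b, curvature G t g ![(Pi.single 0 1, 0), (0, u b)] = δ b :=
    fun t b => by rw [curvature_mixed, hδ]; rfl
  have e' : ∀ t : Fin 2 → ℝ, ∀ b, curvature G t g ![(Pi.single 1 1, 0), (0, u b)] = ε b + δ b :=
    fun t b => by rw [curvature_mixed, hδ, hε, sub_add_sub_cancel]; rfl
  simp [e, e', curvature_simplexVector, volume_simplex_two]
  rw [hs (δ 0) (ε 1), hs (δ 1) (δ 0), hs (δ 1)]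
  ring

theorem chi_three (hs : ∀ x y, f x y = f y x) (g : Fin 4 → G) (u : Fin 1 → Tan G g) :
    chi G f (show 3 + 1 = 4 from rfl) g u = 0 := by
  rw [chi_eq_integral hs (show 3 + 1 = 4 from rfl) g u
    ![(Pi.single 0 1, 0), (Pi.single 1 1, 0), (Pi.single 2 1, 0), (0, u 0)]
    (fun i => by fin_cases i <;> rfl)]
  simp [curvature_simplexVector]

theorem chi_four (hs : ∀ x y, f x y = f y x) (g : Fin 5 → G) (u : Fin 0 → Tan G g) :
    chi G f (show 4 + 0 = 4 from rfl) g u = 0 := by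
  rw [chi_eq_integral hs (show 4 + 0 = 4 from rfl) g u (fun i => (Pi.single i 1, 0))
    (fun i => by fin_cases i <;> rfl)]
  simp [curvature_simplexVector]

theorem leftForm_dGam {p : ℕ} (g : Fin (p + 1) → G) (u : Tan G g) (i : Fin p) :
    leftForm G p i (gam G g) ![dGam G g u] = adjoint G (g i.castSucc)
      (maurerCartanLeft (g i.succ) (u i.succ) - maurerCartanLeft (g i.castSucc) (u i.castSucc)) :=
  maurerCartanLeft_dGam G g u i

theorem rightForm_dGam {p : ℕ} (g : Fin (p + 1) → G) (u : Tan G g) (i : Fin p) :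
    rightForm G p i (gam G g) ![dGam G g u] = adjoint G (g i.succ)
      (maurerCartanLeft (g i.succ) (u i.succ) - maurerCartanLeft (g i.castSucc) (u i.castSucc)) :=
  maurerCartanRight_dGam G g u i

theorem bracket_apply (x y : lieAlg G) : bracket G x y = ⁅x, y⁆ := rfl

theorem isShulmanRep_symplecticForm (hs : ∀ x y, f x y = f y x)
    (hf : ∀ g x y, f (adjoint G g x) (adjoint G g y) = f x y) :
    IsShulmanRep G f (symplecticForm G f) := by
  intro p q h g u
  have hp : p ≤ 4 := by omega
  interval_cases p
  · obtain rfl : q = 4 := by omega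
    exact (chi_zero hs g u).symm
  · obtain rfl : q = 3 := by omega
    rw [chi_one hs g u _ fun b => rfl]
    refine (congrArg _ (wedge_one_two _ _ _ _)).trans ?_
    -- `[ω ∧ ω](x, y) = 2[ω x, ω y]`, which accounts for the factor 2 of `chi_one` against the
    -- coefficient `-1/6`.
    have hb : ∀ x y : lieAlg G, ⁅x, y⁆ - ⁅y, x⁆ = (2 : ℝ) • ⁅x, y⁆ := fun x y => by
      rw [← lie_skew x y]
      module
    have hl := fun b => leftForm_dGam g (u b) 0
    simp only [wedge_one_one, Matrix.cons_val_zero, Matrix.cons_val_one, bracket_apply, hb]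
    simp only [hl, ← LieEquiv.map_lie, map_smul, hf, smul_eq_mul]
    change -(1 / 6) * (_ : ℝ) = _
    rw [show ∀ a b c : ℝ, -2 * (1 / 6) * (a - b + c) = -(1 / 6) * (2 * a - 2 * b + 2 * c)
      from fun a b c => by ring]
    rfl
  · obtain rfl : q = 2 := by omega
    rw [chi_two hs g u _ _ (fun b => rfl) (fun b => rfl)]
    refine (wedge_one_one _ _ _ _).trans ?_
    -- `ω^l` on the second factor and `ω^r` on the first are both twisted by the same `Ad(g_1)`, so
    -- invariance of `f` removes it.
    have hl := fun b => leftForm_dGam g (u b) 1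
    have hr := fun b => rightForm_dGam g (u b) 0
    simp only [hl, hr]
    exact congrArg₂ _ (hf _ _ _) (hf _ _ _)
  · obtain rfl : q = 1 := by omega
    exact (chi_three hs g u).symm
  · obtain rfl : q = 0 := by omega
    exact (chi_four hs g u).symm

end CharacteristicForms

/-! ### The Killing form of `so(n)` as a matrix trace -/

section Killing

open Matrix

variable {n : ℕ}

theorem trace_matrix_end (T : Module.End ℝ (Matrix (Fin n) (Fin n) ℝ)) :
    LinearMap.trace ℝ _ T = ∑ i, ∑ j, T (Matrix.single i j 1) i j := by
  rw [LinearMap.trace_eq_matrix_trace ℝ (Matrix.stdBasis ℝ (Fin n) (Fin n)), Matrix.trace,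
    ← Fintype.sum_prod_type']
  refine Finset.sum_congr rfl fun x _ => ?_
  rw [Matrix.diag_apply, LinearMap.toMatrix_apply, Matrix.stdBasis_eq_single]
  rfl

theorem sum_mul_single_mul (A B : Matrix (Fin n) (Fin n) ℝ) :
    ∑ i, ∑ j, (A * Matrix.single i j (1 : ℝ) * B : Matrix (Fin n) (Fin n) ℝ) i j = A.trace * B.trace := by
  simp [Matrix.mul_apply, Matrix.single_apply, Matrix.trace, Finset.sum_mul_sum, ite_and]

theorem sum_mul_single_transpose_mul (A B : Matrix (Fin n) (Fin n) ℝ) :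
    ∑ i, ∑ j, (A * (Matrix.single i j (1 : ℝ))ᵀ * B : Matrix (Fin n) (Fin n) ℝ) i j = (A * Bᵀ).trace := by
  simp [Matrix.mul_apply, Matrix.single_apply, Matrix.trace, ite_and]

/-- The projection of matrices onto skew-symmetric matrices. -/
def skewProj (n : ℕ) : Module.End ℝ (Matrix (Fin n) (Fin n) ℝ) :=
  (1 / 2 : ℝ) • (LinearMap.id - (Matrix.transposeLinearEquiv (Fin n) (Fin n) ℝ ℝ).toLinearMap)

theorem skewProj_apply (Z : Matrix (Fin n) (Fin n) ℝ) : skewProj n Z = (1 / 2 : ℝ) • (Z - Zᵀ) := rfl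

theorem transpose_skewProj (Z : Matrix (Fin n) (Fin n) ℝ) : (skewProj n Z)ᵀ = -skewProj n Z := by
  simp [skewProj_apply, ← smul_neg]

theorem skewProj_of_skew {Z : Matrix (Fin n) (Fin n) ℝ} (h : Zᵀ = -Z) : skewProj n Z = Z := by
  rw [skewProj_apply, h]
  module

attribute [local instance 10] LieRing.ofAssociativeRing

/-- Expand into maps `Z ↦ AZB`, of trace `tr A · tr B`, and `Z ↦ AZᵀB`, of trace `tr(ABᵀ)`. As `tr X
= 0`, the first kind contributes `n tr(XY)` and the second `-2 tr(XY)`. -/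
theorem trace_ad_ad_skewProj {X Y : Matrix (Fin n) (Fin n) ℝ} (hX : Xᵀ = -X) (hY : Yᵀ = -Y)
    (T : Module.End ℝ (Matrix (Fin n) (Fin n) ℝ))
    (hT : ∀ Z, T Z = ⁅X, ⁅Y, skewProj n Z⁆⁆) :
    LinearMap.trace ℝ _ T = ((n : ℝ) - 2) * (X * Y).trace := by
  have e : ∀ Z, T Z = (1 / 2 : ℝ) • ((X * Y) * Z * 1 - X * Z * Y - Y * Z * X + 1 * Z * (Y * X) -
      ((X * Y) * Zᵀ * 1 - X * Zᵀ * Y - Y * Zᵀ * X + 1 * Zᵀ * (Y * X))) := fun Z => by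
    rw [hT, skewProj_apply]
    simp only [Ring.lie_def, mul_smul_comm, smul_mul_assoc, mul_sub, sub_mul, mul_one, one_mul,
      mul_assoc]
    module
  have hX0 : X.trace = 0 := by
    have := congrArg Matrix.trace hX
    rw [Matrix.trace_transpose, Matrix.trace_neg] at this
    linarith
  rw [trace_matrix_end]
  simp only [e, Matrix.smul_apply, Matrix.sub_apply, Matrix.add_apply, smul_eq_mul,
    ← Finset.mul_sum, Finset.sum_sub_distrib, Finset.sum_add_distrib, sum_mul_single_mul,
    sum_mul_single_transpose_mul, hX0]
  simp [Matrix.transpose_mul, hX, hY, Matrix.trace_mul_comm Y X]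
  ring

/-- `ad x ad y` factors through `ρ`, with `σ ∘ skewProj` as a left inverse of `ρ`. Cyclicity of the
trace moves the computation to all matrices, where the standard basis is available. -/
theorem trace_ad_ad_of_skew {L : Type*} [LieRing L] [LieAlgebra ℝ L] [Module.Finite ℝ L]
    (ρ : L →ₗ[ℝ] Matrix (Fin n) (Fin n) ℝ) (hinj : Function.Injective ρ)
    (hρ : ∀ x y, ρ ⁅x, y⁆ = ⁅ρ x, ρ y⁆) (hskew : ∀ x, (ρ x)ᵀ = -ρ x)
    (hsurj : ∀ Z : Matrix (Fin n) (Fin n) ℝ, Zᵀ = -Z → ∃ x, ρ x = Z) (x y : L) :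
    killingForm ℝ L x y = ((n : ℝ) - 2) * (ρ x * ρ y).trace := by
  obtain ⟨σ, hσ⟩ := ρ.exists_leftInverse_of_injective (LinearMap.ker_eq_bot.2 hinj)
  have hσ' : ∀ z, σ (ρ z) = z := fun z => LinearMap.congr_fun hσ z
  have hP : ∀ Z, ρ (σ (skewProj n Z)) = skewProj n Z := fun Z => by
    obtain ⟨z, hz⟩ := hsurj _ (transpose_skewProj Z)
    rw [← hz, hσ']
  set φ : Module.End ℝ L := LieAlgebra.ad ℝ L x * LieAlgebra.ad ℝ L y with hφ
  have h1 : φ = (φ.comp (σ.comp (skewProj n))).comp ρ := by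
    refine LinearMap.ext fun z => ?_
    simp [skewProj_of_skew (hskew z), hσ']
  have h2 : killingForm ℝ L x y = LinearMap.trace ℝ L φ := rfl
  rw [h2, h1, LinearMap.trace_comp_comm']
  refine trace_ad_ad_skewProj (hskew x) (hskew y) _ fun Z => ?_
  simp [hφ, hρ, hP]

theorem pontryaginOne_apply (X Y : Matrix (Fin n) (Fin n) ℝ) :
    pontryaginOne n X Y = 1 / (8 * Real.pi ^ 2) * (X.trace * Y.trace - (X * Y).trace) := by
  simp [pontryaginOne, pontryaginPoly_two, add_mul, mul_add, Matrix.trace_mul_comm Y X]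
  ring

/-! ### Comparison of the Pontryagin and Killing forms -/

section Main

variable {A : Type*} [NormedRing A] [NormedAlgebra ℝ A] [FiniteDimensional ℝ A]

theorem wedge_smul_form {M F F' F'' : Type*} [AddCommGroup M] [Module ℝ M] [AddCommGroup F]
    [Module ℝ F] [AddCommGroup F'] [Module ℝ F'] [AddCommGroup F''] [Module ℝ F''] {j k : ℕ}
    (r : ℝ) (B : F →ₗ[ℝ] F' →ₗ[ℝ] F'') (φ : M [⋀^Fin j]→ₗ[ℝ] F) (ψ : M [⋀^Fin k]→ₗ[ℝ] F') :
    wedge (r • B) φ ψ = r • wedge B φ ψ := by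
  refine AlternatingMap.ext fun v => ?_
  simp only [wedge_apply, AlternatingMap.smul_apply, LinearMap.smul_apply, Finset.smul_sum]
  refine Finset.sum_congr rfl fun σ _ => ?_
  rw [smul_comm _ r, smul_comm _ r]

theorem symplecticForm_smul (G : Subgroup Aˣ) (r : ℝ) (B : LinearMap.BilinForm ℝ (lieAlg G)) :
    symplecticForm G (r • B) = r • symplecticForm G B := by
  funext ⟨⟨p, q⟩, h⟩
  have h' : p + q = 4 := h
  have hp : p ≤ 4 := by omega
  interval_cases p
  · obtain rfl : q = 4 := by omega
    exact (smul_zero r).symm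
  · obtain rfl : q = 3 := by omega
    funext g
    change (-(1 / 6 : ℝ)) • wedge (j := 1) (k := 2) (r • B) _ _ =
      r • ((-(1 / 6 : ℝ)) • wedge (j := 1) (k := 2) B _ _)
    rw [wedge_smul_form, smul_comm]
  · obtain rfl : q = 2 := by omega
    funext g
    exact wedge_smul_form (j := 1) (k := 1) r B _ _
  · obtain rfl : q = 1 := by omega
    exact (smul_zero r).symm
  · obtain rfl : q = 0 := by omega
    exact (smul_zero r).symm

theorem isShulmanRep_pontryaginForm_iff (hn : 3 ≤ n) {c : ℝ} (hc : c ≠ 0) (G : Subgroup Aˣ)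
    (ρ : lieAlg G →ₗ[ℝ] Matrix (Fin n) (Fin n) ℝ) (hinj : Function.Injective ρ)
    (hρ : ∀ x y, ρ ⁅x, y⁆ = ⁅ρ x, ρ y⁆) (hskew : ∀ x, (ρ x)ᵀ = -ρ x)
    (hsurj : ∀ Z : Matrix (Fin n) (Fin n) ℝ, Zᵀ = -Z → ∃ x, ρ x = Z) (Φ : Tot G 4) :
    IsShulmanRep G (pontryaginForm G ρ) Φ ↔
      Φ = (-(1 / (8 * ((n : ℝ) - 2) * c * Real.pi ^ 2))) • symplecticForm G (c • killing G) := by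
  have hn' : (n : ℝ) - 2 ≠ 0 := by
    have : (3 : ℝ) ≤ n := by exact_mod_cast hn
    linarith
  have hf : pontryaginForm G ρ =
      (-(1 / (8 * ((n : ℝ) - 2) * c * Real.pi ^ 2))) • (c • killing G) := by
    refine LinearMap.ext₂ fun x y => ?_
    have h0 : ∀ x, (ρ x).trace = 0 := fun x => by
      have := congrArg Matrix.trace (hskew x)
      rw [Matrix.trace_transpose, Matrix.trace_neg] at this
      linarith
    have h1 : killing G x y = ((n : ℝ) - 2) * (ρ x * ρ y).trace :=
      trace_ad_ad_of_skew ρ hinj hρ hskew hsurj x y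
    have h2 : pontryaginForm G ρ x y = pontryaginOne n (ρ x) (ρ y) := rfl
    rw [h2, pontryaginOne_apply, h0]
    simp only [LinearMap.smul_apply, smul_eq_mul, h1]
    have := Real.pi_ne_zero
    field_simp
    ring
  have hrep : IsShulmanRep G (pontryaginForm G ρ)
      ((-(1 / (8 * ((n : ℝ) - 2) * c * Real.pi ^ 2))) • symplecticForm G (c • killing G)) := by
    rw [← symplecticForm_smul, ← hf]
    -- Being a multiple of the Killing form, the Pontryagin form is invariant under every Lie
    -- algebra automorphism, in particular under `Ad`.
    refine isShulmanRep_symplecticForm (fun x y => ?_) (fun g x y => ?_)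
    · simp only [hf, LinearMap.smul_apply]
      exact congrArg _ (congrArg _ (LieModule.traceForm_comm ℝ (lieAlg G) (lieAlg G) x y))
    · simp only [hf, LinearMap.smul_apply]
      exact congrArg _ (congrArg _ (LieAlgebra.killingForm_of_equiv_apply (adjoint G g) x y))
  exact ⟨fun h => h.unique G hrep, fun h => h ▸ hrep⟩

end Main
end Killing

/-! ### The Lie algebras of `O(n)` and `SO(n)` -/

section Orthogonal

open Matrix

variable {n : ℕ}

attribute [local instance 10] LieRing.ofAssociativeRing

/-- Differentiate `gᵀ = g⁻¹` along a curve through 1. -/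
theorem transpose_of_mem_lieAlg {G : Subgroup (Matrix (Fin n) (Fin n) ℝ)ˣ} (hG : G ≤ orthGroup n)
    (X : lieAlg G) : (X : Matrix (Fin n) (Fin n) ℝ)ᵀ = -X := by
  obtain ⟨c, -, hc0, hcX⟩ := X.2
  have h1 := hasDerivAt_el_inv hcX
  have h2 := (LinearMap.toContinuousLinearMap
    (Matrix.transposeLinearEquiv (Fin n) (Fin n) ℝ ℝ).toLinearMap).hasFDerivAt.comp_hasDerivAt
      (0 : ℝ) hcX
  have e : ∀ t, (el (c t))ᵀ = el (c t)⁻¹ := fun t => by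
    have h := ((Submonoid.mem_units_iff _ _).1 (hG (c t).2)).1
    have h' : el (c t) * (el (c t))ᵀ = 1 := (Matrix.mem_orthogonalGroup_iff (Fin n) ℝ).1 h
    calc (el (c t))ᵀ = el (c t)⁻¹ * (el (c t) * (el (c t))ᵀ) := by
          rw [← mul_assoc]; simp [el]
      _ = _ := by rw [h', mul_one]
  have h3 : (X : Matrix (Fin n) (Fin n) ℝ)ᵀ = -(el (c 0)⁻¹ * X * el (c 0)⁻¹) := h2.unique (h1.congr_of_eventuallyEq (Filter.Eventually.of_forall e))
  simpa [hc0, el] using h3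

/-- The exponential as a unit. -/
def expUnit (Z : Matrix (Fin n) (Fin n) ℝ) : (Matrix (Fin n) (Fin n) ℝ)ˣ where
  val := NormedSpace.exp Z
  inv := NormedSpace.exp (-Z)
  val_inv := by
    rw [← Matrix.exp_add_of_commute _ _ (Commute.neg_right (Commute.refl Z)), add_neg_cancel,
      NormedSpace.exp_zero]
  inv_val := by
    rw [← Matrix.exp_add_of_commute _ _ (Commute.neg_left (Commute.refl Z)), neg_add_cancel,
      NormedSpace.exp_zero]

theorem exp_mem_specialOrthogonalGroup {Z : Matrix (Fin n) (Fin n) ℝ} (hZ : Zᵀ = -Z) :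
    NormedSpace.exp Z ∈ Matrix.specialOrthogonalGroup (Fin n) ℝ := by
  have h : ∀ Y : Matrix (Fin n) (Fin n) ℝ, Yᵀ = -Y →
      NormedSpace.exp Y ∈ Matrix.orthogonalGroup (Fin n) ℝ := fun Y hY => by
    rw [Matrix.mem_orthogonalGroup_iff]
    change NormedSpace.exp Y * (NormedSpace.exp Y)ᵀ = 1
    rw [← Matrix.exp_transpose, hY]
    exact (expUnit Y).val_inv
  rw [Matrix.mem_specialOrthogonalGroup_iff]
  refine ⟨h Z hZ, ?_⟩
  -- Halving gives determinant 1 without a formula for `det exp`: `det (exp Z) = det (exp Y)²`,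
  -- which is 1 by orthogonality of `exp Y`.
  set Y := (1 / 2 : ℝ) • Z with hY
  have hYs : Yᵀ = -Y := by rw [hY, Matrix.transpose_smul, hZ, smul_neg]
  have e : NormedSpace.exp Z = NormedSpace.exp Y * NormedSpace.exp Y := by
    rw [← Matrix.exp_add_of_commute _ _ (Commute.refl Y)]
    congr 1
    rw [hY]
    module
  have h1 := congrArg Matrix.det ((Matrix.mem_orthogonalGroup_iff (Fin n) ℝ).1 (h Y hYs))
  have h2 : (NormedSpace.exp Y).det * (NormedSpace.exp Y)ᵀ.det = 1 := by
    rw [← Matrix.det_mul, ← Matrix.det_one (n := Fin n) (R := ℝ)]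
    exact h1
  rw [e, Matrix.det_mul]
  rwa [Matrix.det_transpose] at h2

theorem mem_lieAlg_of_transpose {G : Subgroup (Matrix (Fin n) (Fin n) ℝ)ˣ}
    (hG : specialOrthGroup n ≤ G) {Z : Matrix (Fin n) (Fin n) ℝ} (hZ : Zᵀ = -Z) :
    Z ∈ lieAlg G := by
  have hm : ∀ t : ℝ, expUnit (t • Z) ∈ G := fun t => by
    have h : (t • Z)ᵀ = -(t • Z) := by rw [Matrix.transpose_smul, hZ, smul_neg]
    refine hG ((Submonoid.mem_units_iff _ _).2
      ⟨exp_mem_specialOrthogonalGroup h, exp_mem_specialOrthogonalGroup (Z := -(t • Z)) ?_⟩)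
    rw [Matrix.transpose_neg, h]
  refine ⟨fun t => ⟨expUnit (t • Z), hm t⟩, ?_, ?_, ?_⟩
  · change ContDiff ℝ ∞ fun t : ℝ => NormedSpace.exp (t • Z)
    rw [contDiff_iff_contDiffAt]
    intro t
    exact ((NormedSpace.exp_analytic (𝕂 := ℝ) (t • Z)).contDiffAt).comp t
      (contDiffAt_id.smul contDiffAt_const)
  · refine Subtype.ext (Units.ext ?_)
    change NormedSpace.exp ((0 : ℝ) • Z) = 1
    rw [zero_smul, NormedSpace.exp_zero]
  · have h := hasDerivAt_exp_smul_const (𝕂 := ℝ) Z 0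
    rw [zero_smul, NormedSpace.exp_zero, one_mul] at h
    exact h

theorem isShulmanRep_matrixRep_iff (hn : 3 ≤ n) {c : ℝ} (hc : c ≠ 0)
    {G : Subgroup (Matrix (Fin n) (Fin n) ℝ)ˣ} (h1 : specialOrthGroup n ≤ G)
    (h2 : G ≤ orthGroup n) (Φ : Tot G 4) :
    IsShulmanRep G (pontryaginForm G (matrixRep G)) Φ ↔
      Φ = (-(1 / (8 * ((n : ℝ) - 2) * c * Real.pi ^ 2))) • symplecticForm G (c • killing G) :=
  isShulmanRep_pontryaginForm_iff hn hc G (matrixRep G) Subtype.val_injective (fun _ _ => rfl)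
    (transpose_of_mem_lieAlg h2) (fun Z hZ => ⟨⟨Z, mem_lieAlg_of_transpose h1 hZ⟩, rfl⟩) Φ

theorem specialOrthGroup_le_orthGroup : specialOrthGroup n ≤ orthGroup n := fun _ hg =>
  (Submonoid.mem_units_iff _ _).2
    ⟨(Matrix.mem_specialOrthogonalGroup_iff.1 ((Submonoid.mem_units_iff _ _).1 hg).1).1,
      (Matrix.mem_specialOrthogonalGroup_iff.1 ((Submonoid.mem_units_iff _ _).1 hg).2).1⟩

end Orthogonal

/-! ### Even Clifford elements commuting with all vectors are scalars -/

section ScalarsOfContraction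

open CliffordAlgebra

variable {n : ℕ}

/-- The Euler operator `∑ eᵢ ∧ (eᵢ* ⌋ x)` of the exterior algebra. -/
def eulerOp (n : ℕ) : Module.End ℝ (ExteriorAlgebra ℝ (Fin n → ℝ)) :=
  ∑ i, (LinearMap.mulLeft ℝ (ExteriorAlgebra.ι ℝ (Pi.single i 1))).comp
    (contractLeft (Q := (0 : QuadraticForm ℝ (Fin n → ℝ))) (LinearMap.proj i))

theorem eulerOp_apply (x : ExteriorAlgebra ℝ (Fin n → ℝ)) :
    eulerOp n x = ∑ i, ExteriorAlgebra.ι ℝ (Pi.single i 1) *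
      contractLeft (Q := (0 : QuadraticForm ℝ (Fin n → ℝ))) (LinearMap.proj i) x := by
  simp [eulerOp]

theorem sum_smul_ι_single (v : Fin n → ℝ) :
    ∑ i, v i • ExteriorAlgebra.ι ℝ (Pi.single i (1 : ℝ)) = ExteriorAlgebra.ι ℝ v := by
  conv_rhs => rw [pi_eq_sum_univ' v, map_sum]
  refine Finset.sum_congr rfl fun i _ => ?_
  rw [map_smul]

/-- Contraction is an antiderivation, so multiplying by a vector raises the eigenvalue by one: `E(v
∧ x) = v ∧ x + v ∧ E x`. -/
theorem eulerOp_of_mem {k : ℕ} {x : ExteriorAlgebra ℝ (Fin n → ℝ)}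
    (hx : x ∈ ⋀[ℝ]^k (Fin n → ℝ)) : eulerOp n x = (k : ℝ) • x := by
  induction hx using Submodule.pow_induction_on_left' with
  | algebraMap r =>
    rw [eulerOp_apply, Nat.cast_zero, zero_smul]
    refine Finset.sum_eq_zero fun i _ => ?_
    have h : contractLeft (Q := (0 : QuadraticForm ℝ (Fin n → ℝ))) (LinearMap.proj i)
      (algebraMap ℝ _ r) = 0 := contractLeft_algebraMap _ _ _
    exact (congrArg _ h).trans (mul_zero _)
  | add x y i _ _ hx hy => rw [map_add, hx, hy, smul_add]
  | mem_mul m hm i x hx ih =>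
    obtain ⟨v, rfl⟩ := hm
    have h : ∀ j, contractLeft (Q := (0 : QuadraticForm ℝ (Fin n → ℝ))) (LinearMap.proj j)
        (ExteriorAlgebra.ι ℝ v * x) = v j • x - ExteriorAlgebra.ι ℝ v *
          contractLeft (Q := (0 : QuadraticForm ℝ (Fin n → ℝ))) (LinearMap.proj j) x := fun j =>
      contractLeft_ι_mul _ _ _
    rw [eulerOp_apply] at ih ⊢
    simp only [h]
    have h' : ∀ j, ExteriorAlgebra.ι ℝ (Pi.single j (1 : ℝ)) * (v j • x - ExteriorAlgebra.ι ℝ v *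
          contractLeft (Q := (0 : QuadraticForm ℝ (Fin n → ℝ))) (LinearMap.proj j) x) =
        (v j • ExteriorAlgebra.ι ℝ (Pi.single j (1 : ℝ))) * x +
        ExteriorAlgebra.ι ℝ v * (ExteriorAlgebra.ι ℝ (Pi.single j (1 : ℝ)) *
          contractLeft (Q := (0 : QuadraticForm ℝ (Fin n → ℝ))) (LinearMap.proj j) x) := fun j => by
      rw [mul_sub, mul_smul_comm, smul_mul_assoc, sub_eq_add_neg, ← mul_assoc, ← mul_assoc,
        eq_neg_of_add_eq_zero_left (ExteriorAlgebra.ι_add_mul_swap (R := ℝ) v (Pi.single j 1)),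
        neg_mul]
    simp only [h', Finset.sum_add_distrib, ← Finset.sum_mul, ← Finset.mul_sum, ih,
      sum_smul_ι_single]
    rw [mul_smul_comm, Nat.cast_succ]
    module

theorem decompose_eulerOp (x : ExteriorAlgebra ℝ (Fin n → ℝ)) (k : ℕ) :
    (DirectSum.decompose (fun i : ℕ => ⋀[ℝ]^i (Fin n → ℝ)) (eulerOp n x) k :
      ExteriorAlgebra ℝ (Fin n → ℝ)) =
      (k : ℝ) • (DirectSum.decompose (fun i : ℕ => ⋀[ℝ]^i (Fin n → ℝ)) x k :
        ExteriorAlgebra ℝ (Fin n → ℝ)) := by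
  induction x using DirectSum.Decomposition.inductionOn (fun i : ℕ => ⋀[ℝ]^i (Fin n → ℝ)) with
  | zero => simp
  | @homogeneous i m =>
    rw [eulerOp_of_mem m.2, DirectSum.decompose_smul]
    change (i : ℝ) • (DirectSum.decompose (fun i : ℕ => ⋀[ℝ]^i (Fin n → ℝ)) (m : _) k :
        ExteriorAlgebra ℝ (Fin n → ℝ)) = _
    by_cases h : i = k
    · subst h; rfl
    · rw [DirectSum.decompose_of_mem_ne (fun i : ℕ => ⋀[ℝ]^i (Fin n → ℝ)) m.2 h, smul_zero, smul_zero]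
  | add x y hx hy =>
    rw [map_add, DirectSum.decompose_add, DirectSum.decompose_add, DirectSum.add_apply,
      DirectSum.add_apply, Submodule.coe_add, Submodule.coe_add, hx, hy, smul_add]

theorem mem_range_algebraMap_of_eulerOp {x : ExteriorAlgebra ℝ (Fin n → ℝ)}
    (hx : eulerOp n x = 0) : ∃ r : ℝ, x = algebraMap ℝ _ r := by
  have h : ∀ k, k ≠ 0 → (DirectSum.decompose (fun i : ℕ => ⋀[ℝ]^i (Fin n → ℝ)) x k :
      ExteriorAlgebra ℝ (Fin n → ℝ)) = 0 := fun k hk => by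
    have := decompose_eulerOp x k
    rw [hx, DirectSum.decompose_zero] at this
    exact (smul_eq_zero.1 this.symm).resolve_left (by exact_mod_cast hk)
  have h0 : x ∈ ⋀[ℝ]^0 (Fin n → ℝ) := by
    classical
    rw [← DirectSum.sum_support_decompose (fun i : ℕ => ⋀[ℝ]^i (Fin n → ℝ)) x]
    refine Submodule.sum_mem _ fun k _ => ?_
    by_cases hk : k = 0
    · subst hk
      exact (DirectSum.decompose (fun i : ℕ => ⋀[ℝ]^i (Fin n → ℝ)) x 0).2
    · rw [h k hk]
      exact Submodule.zero_mem _
  obtain ⟨r, hr⟩ := Submodule.mem_one.1 (by simpa using h0)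
  exact ⟨r, hr.symm⟩

/-- `equivExterior` intertwines the contractions, so the image of `x` is killed by the Euler
operator, which acts on degree `k` as `k`; only degree 0 survives. -/
theorem mem_range_algebraMap_of_contractLeft {x : Cliff n}
    (hx : ∀ i : Fin n, contractLeft (LinearMap.proj i) x = 0) : ∃ r : ℝ, x = algebraMap ℝ _ r := by
  have h : eulerOp n (equivExterior (cliffForm n) x) = 0 := by
    rw [eulerOp_apply]
    refine Finset.sum_eq_zero fun i _ => ?_
    have := changeForm_contractLeft (changeForm.associated_neg_proof (Q := cliffForm n))
      (LinearMap.proj i) x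
    rw [hx i, map_zero] at this
    exact (congrArg _ this.symm).trans (mul_zero _)
  obtain ⟨r, hr⟩ := mem_range_algebraMap_of_eulerOp h
  refine ⟨r, (equivExterior (cliffForm n)).injective (hr.trans ?_)⟩
  exact (changeForm_algebraMap (changeForm.associated_neg_proof (Q := cliffForm n)) r).symm

theorem polar_cliffForm (v w : Fin n → ℝ) :
    QuadraticMap.polar (cliffForm n) v w = -2 * ∑ i, v i * w i := by
  simp only [QuadraticMap.polar, QuadraticMap.weightedSumSquares_apply, Finset.mul_sum,
    ← Finset.sum_sub_distrib, Pi.add_apply, smul_eq_mul]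
  exact Finset.sum_congr rfl fun i _ => by ring

/-- Both sides obey the same twisted Leibniz rule under left multiplication by a vector. For even
`x` the left side is the ordinary commutator, so commuting with vectors becomes vanishing of
contractions. -/
theorem ι_mul_sub_involute_mul_ι (v : Fin n → ℝ) (x : Cliff n) :
    ι (cliffForm n) v * x - involute x * ι (cliffForm n) v =
      contractLeft ((QuadraticMap.polarBilin (cliffForm n)) v) x := by
  induction x using CliffordAlgebra.left_induction with
  | algebraMap r =>
    rw [contractLeft_algebraMap, involute.commutes, Algebra.commutes, sub_self]
  | add x y hx hy =>
    rw [map_add, map_add, ← hx, ← hy]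
    noncomm_ring
  | ι_mul x m hx =>
    rw [contractLeft_ι_mul, ← hx, map_mul, involute_ι]
    have h : ι (cliffForm n) v * ι (cliffForm n) m = algebraMap ℝ (Cliff n)
        (QuadraticMap.polar (cliffForm n) v m) - ι (cliffForm n) m * ι (cliffForm n) v :=
      eq_sub_of_add_eq (ι_mul_ι_add_swap v m)
    rw [← mul_assoc, h, QuadraticMap.polarBilin_apply_apply, Algebra.smul_def]
    noncomm_ring

theorem mem_range_algebraMap_of_commute {x : Cliff n} (hi : involute x = x)
    (hx : ∀ v, x * ι (cliffForm n) v = ι (cliffForm n) v * x) : ∃ r : ℝ, x = algebraMap ℝ _ r := by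
  refine mem_range_algebraMap_of_contractLeft fun i => ?_
  have h := ι_mul_sub_involute_mul_ι (Pi.single i 1) x
  rw [hi, hx, sub_self] at h
  have e : (LinearMap.proj i : (Fin n → ℝ) →ₗ[ℝ] ℝ) =
      (-(1 / 2 : ℝ)) • (QuadraticMap.polarBilin (cliffForm n)) (Pi.single i 1) := by
    refine LinearMap.ext fun w => ?_
    rw [LinearMap.smul_apply, QuadraticMap.polarBilin_apply_apply, polar_cliffForm]
    simp [Pi.single_apply]
  rw [e, map_smul, LinearMap.smul_apply, ← h, smul_zero]

end ScalarsOfContraction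

/-! ### The Lie algebra of `Spin(n)` and the differential of the covering -/

section Spin

open CliffordAlgebra

variable {n : ℕ}

attribute [local instance 10] LieRing.ofAssociativeRing

theorem ι_cliffForm_injective : Function.Injective (ι (cliffForm n)) := fun v w h => by
  rw [← cliffInv_ι n v, h, cliffInv_ι]

theorem hasDerivAt_linearMap_comp {E F : Type*} [NormedAddCommGroup E] [NormedSpace ℝ E]
    [FiniteDimensional ℝ E] [NormedAddCommGroup F] [NormedSpace ℝ F] (L : E →ₗ[ℝ] F)
    {c : ℝ → E} {X : E} {t : ℝ} (hc : HasDerivAt c X t) :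
    HasDerivAt (fun s => L (c s)) (L X) t :=
  (LinearMap.toContinuousLinearMap L).hasFDerivAt.comp_hasDerivAt t hc

/-- That the commutator is again a vector, so that `cliffInv` loses nothing, follows by
differentiating `ι_spinCover` along a curve. -/
theorem ι_spinRep_mulVec (X : lieAlg (spinGrp n)) (v : Fin n → ℝ) :
    ι (cliffForm n) ((spinRep n X).mulVec v) =
      X * ι (cliffForm n) v - ι (cliffForm n) v * (X : Cliff n) := by
  obtain ⟨c, -, hc0, hc⟩ := X.2
  have h1 := hasDerivAt_linearMap_comp (ι (cliffForm n)) (hasDerivAt_spinCover n c X hc0 hc v)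
  have h2 := (hc.mul_const (ι (cliffForm n) v)).mul (hasDerivAt_el_inv hc)
  have h3 := h1.unique (h2.congr_of_eventuallyEq
    (Filter.Eventually.of_forall fun t => ι_spinCover n (c t) v))
  rw [h3]
  simp [el, hc0, sub_eq_add_neg]

theorem spinRep_lie (X Y : lieAlg (spinGrp n)) :
    spinRep n ⁅X, Y⁆ = ⁅spinRep n X, spinRep n Y⁆ := by
  refine Matrix.ext_of_mulVec_single fun i => ι_cliffForm_injective ?_
  rw [ι_spinRep_mulVec, Ring.lie_def, Matrix.sub_mulVec, map_sub, ← Matrix.mulVec_mulVec,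
    ← Matrix.mulVec_mulVec]
  simp only [ι_spinRep_mulVec, LieSubalgebra.coe_bracket, Ring.lie_def]
  noncomm_ring

/-- The commutator with `X` is a derivation and kills the scalar `vw + wv`, so the polar form is
infinitesimally invariant. -/
theorem transpose_spinRep (X : lieAlg (spinGrp n)) : (spinRep n X).transpose = -spinRep n X := by
  have h : ∀ v w : Fin n → ℝ, QuadraticMap.polar (cliffForm n) ((spinRep n X).mulVec v) w +
      QuadraticMap.polar (cliffForm n) ((spinRep n X).mulVec w) v = 0 := fun v w => by
    refine (algebraMap ℝ (Cliff n)).injective ?_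
    rw [map_add, map_zero, ← ι_mul_ι_add_swap, ← ι_mul_ι_add_swap, ι_spinRep_mulVec,
      ι_spinRep_mulVec]
    have h2 := (Algebra.commutes (QuadraticMap.polar (cliffForm n) v w) (X : Cliff n)).symm
    rw [← ι_mul_ι_add_swap] at h2
    rw [← sub_eq_zero] at h2
    rw [← h2]
    noncomm_ring
  ext i j
  have h1 := h (Pi.single i 1) (Pi.single j 1)
  simp only [polar_cliffForm, Matrix.mulVec_single_one, Matrix.col_apply, Pi.single_apply, mul_ite,
    mul_one, mul_zero, Finset.sum_ite_eq', Finset.mem_univ, if_true] at h1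
  rw [Matrix.transpose_apply, Matrix.neg_apply]
  linarith

theorem involute_of_mem_lieAlg (X : lieAlg (spinGrp n)) :
    involute (X : Cliff n) = X := by
  obtain ⟨c, -, -, hc⟩ := X.2
  refine (hasDerivAt_linearMap_comp (involute (Q := cliffForm n)).toLinearMap hc).unique
    (hc.congr_of_eventuallyEq (Filter.Eventually.of_forall fun t => ?_))
  exact spinGroup.involute_eq ((Submonoid.mem_units_iff _ _).1 (c t).2).1

theorem reverse_of_mem_lieAlg (X : lieAlg (spinGrp n)) :
    reverse (X : Cliff n) = -X := by
  obtain ⟨c, -, hc0, hc⟩ := X.2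
  have h := (hasDerivAt_linearMap_comp (reverse (Q := cliffForm n)) hc).unique
    ((hasDerivAt_el_inv hc).congr_of_eventuallyEq (Filter.Eventually.of_forall fun t => ?_))
  · rw [h]
    simp [el, hc0]
  · have hm := ((Submonoid.mem_units_iff _ _).1 (c t).2).1
    have h1 := spinGroup.star_mul_self_of_mem hm
    rw [star_def, spinGroup.involute_eq hm] at h1
    calc reverse (el (c t)) = reverse (el (c t)) * el (c t) * el (c t)⁻¹ := by simp [el, mul_assoc]
      _ = el (c t)⁻¹ := by
        rw [show reverse (el (c t)) * el (c t) = 1 from h1, one_mul]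

theorem spinRep_injective : Function.Injective (spinRep n) := by
  refine (injective_iff_map_eq_zero _).2 fun X hX => Subtype.ext ?_
  have h : ∀ v, (X : Cliff n) * ι (cliffForm n) v = ι (cliffForm n) v * X := fun v => by
    rw [← sub_eq_zero, ← ι_spinRep_mulVec, hX, Matrix.zero_mulVec, map_zero]
  obtain ⟨r, hr⟩ := mem_range_algebraMap_of_commute (involute_of_mem_lieAlg X) h
  have h1 := reverse_of_mem_lieAlg X
  rw [hr, reverse.commutes, ← hr] at h1
  have h2 : (2 : ℝ) • (X : Cliff n) = 0 := by
    rw [two_smul]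
    nth_rewrite 1 [h1]
    exact neg_add_cancel _
  exact (smul_eq_zero.1 h2).resolve_left two_ne_zero

/-- A unit vector as a unit of the Clifford algebra. -/
def vectorUnit {v : Fin n → ℝ} (hv : cliffForm n v = -1) : (Cliff n)ˣ where
  val := ι (cliffForm n) v
  inv := -ι (cliffForm n) v
  val_inv := by rw [mul_neg, ι_sq_scalar, hv, map_neg, map_one, neg_neg]
  inv_val := by rw [neg_mul, ι_sq_scalar, hv, map_neg, map_one, neg_neg]

theorem ι_mul_ι_mem_spinGroup {v w : Fin n → ℝ} (hv : cliffForm n v = -1)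
    (hw : cliffForm n w = -1) :
    ι (cliffForm n) v * ι (cliffForm n) w ∈ spinGroup (cliffForm n) := by
  have hp : ∀ {v : Fin n → ℝ}, cliffForm n v = -1 →
      ι (cliffForm n) v ∈ pinGroup (cliffForm n) := fun {v} hv =>
    pinGroup.units_mem_iff (x := vectorUnit hv).2 ⟨Subgroup.subset_closure ⟨v, rfl⟩,
      Unitary.mem_iff.2 ⟨by rw [vectorUnit, star_ι]; exact (vectorUnit hv).inv_val,
        by rw [vectorUnit, star_ι]; exact (vectorUnit hv).val_inv⟩⟩
  exact spinGroup.mem_iff.2 ⟨mul_mem (hp hv) (hp hw), ι_mul_ι_mem_evenOdd_zero _ _ _⟩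

theorem vectorUnit_mul_mem_spinGrp {v w : Fin n → ℝ} (hv : cliffForm n v = -1)
    (hw : cliffForm n w = -1) : vectorUnit hv * vectorUnit hw ∈ spinGrp n := by
  refine (Submonoid.mem_units_iff _ _).2 ⟨ι_mul_ι_mem_spinGroup hv hw, ?_⟩
  have h : (((vectorUnit hv * vectorUnit hw)⁻¹ : (Cliff n)ˣ) : Cliff n) =
      ι (cliffForm n) w * ι (cliffForm n) v := by
    rw [mul_inv_rev, Units.val_mul]
    exact neg_mul_neg _ _
  rw [h]
  exact ι_mul_ι_mem_spinGroup hw hv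

theorem ι_mul_ι_mem_lieAlg {i j : Fin n} (hij : i ≠ j) :
    ι (cliffForm n) (Pi.single i 1) * ι (cliffForm n) (Pi.single j 1) ∈ lieAlg (spinGrp n) := by
  have hu : cliffForm n (-Pi.single i 1) = -1 := by
    rw [QuadraticMap.map_neg, QuadraticMap.weightedSumSquares_apply]
    simp [Pi.single_apply]
  -- The curve is `(-e_i)(cos t e_i - sin t e_j)`: it starts at `-e_i² = 1` with velocity
  -- `(-e_i)(-e_j) = e_i e_j`.
  set w : ℝ → Fin n → ℝ := fun t => Real.cos t • Pi.single i 1 - Real.sin t • Pi.single j 1 with hw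
  have hv : ∀ t, cliffForm n (w t) = -1 := fun t => by
    have h0 := polar_cliffForm (Real.cos t • Pi.single i (1 : ℝ)) (-(Real.sin t • Pi.single j (1 : ℝ)))
    rw [QuadraticMap.polar, ← sub_eq_add_neg] at h0
    have h1 : ∀ k : Fin n, cliffForm n (Pi.single k 1) = -1 := fun k => by
      rw [QuadraticMap.weightedSumSquares_apply]
      simp [Pi.single_apply]
    have h2 : ∑ x, (Real.cos t • Pi.single i (1 : ℝ) : Fin n → ℝ) x *
        (-(Real.sin t • Pi.single j (1 : ℝ)) : Fin n → ℝ) x = 0 :=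
      Finset.sum_eq_zero fun x _ => by
        by_cases hx : x = i
        · subst hx
          simp [hij]
        · simp [Pi.single_apply, hx]
    rw [h2, QuadraticMap.map_neg, QuadraticMap.map_smul, QuadraticMap.map_smul, h1, h1] at h0
    have h3 := Real.sin_sq_add_cos_sq t
    simp only [smul_eq_mul] at h0
    linarith
  have hd : HasDerivAt w (-Pi.single j 1) 0 := by
    have h : HasDerivAt w _ 0 := ((Real.hasDerivAt_cos 0).smul_const (Pi.single i (1 : ℝ) : Fin n → ℝ)).sub
      ((Real.hasDerivAt_sin 0).smul_const (Pi.single j (1 : ℝ) : Fin n → ℝ))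
    simpa using h
  refine ⟨fun t => ⟨vectorUnit hu * vectorUnit (hv t), vectorUnit_mul_mem_spinGrp _ _⟩, ?_, ?_, ?_⟩
  · change ContDiff ℝ ∞ fun t => ι (cliffForm n) (-Pi.single i 1) * ι (cliffForm n) (w t)
    refine contDiff_const.mul ((LinearMap.toContinuousLinearMap
      (ι (cliffForm n))).contDiff.comp ?_)
    exact (Real.contDiff_cos.smul contDiff_const).sub (Real.contDiff_sin.smul contDiff_const)
  · refine Subtype.ext (Units.ext ?_)
    change ι (cliffForm n) (-Pi.single i 1) * ι (cliffForm n) (w 0) = 1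
    have : w 0 = - -Pi.single i 1 := by simp [hw]
    rw [this, map_neg _ (-Pi.single i 1)]
    exact (vectorUnit hu).val_inv
  · refine ((hasDerivAt_linearMap_comp (ι (cliffForm n)) hd).const_mul
      (ι (cliffForm n) (-Pi.single i 1))).congr_deriv ?_
    rw [map_neg, map_neg, neg_mul_neg]

theorem exists_spinRep_eq_single_sub (i j : Fin n) :
    ∃ X, spinRep n X = (2 : ℝ) • (Matrix.single j i 1 - Matrix.single i j 1) := by
  by_cases hij : i = j
  · exact ⟨0, by rw [hij, sub_self, smul_zero, map_zero]⟩
  · refine ⟨⟨_, ι_mul_ι_mem_lieAlg hij⟩, Matrix.ext_of_mulVec_single fun k =>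
      ι_cliffForm_injective ?_⟩
    rw [ι_spinRep_mulVec]
    -- `abv - vab = a(bv + vb) - (av + va)b`, and the anticommutators are scalars.
    have h1 : ∀ a b v : Fin n → ℝ, ι (cliffForm n) a * ι (cliffForm n) b * ι (cliffForm n) v -
        ι (cliffForm n) v * (ι (cliffForm n) a * ι (cliffForm n) b) =
        ι (cliffForm n) (QuadraticMap.polar (cliffForm n) b v • a -
          QuadraticMap.polar (cliffForm n) a v • b) := fun a b v => by
      rw [map_sub, map_smul, map_smul, Algebra.smul_def, Algebra.smul_def, Algebra.commutes,
        ← ι_mul_ι_add_swap, ← ι_mul_ι_add_swap]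
      noncomm_ring
    rw [h1]
    congr 1
    funext l
    have h2 : ∀ a b : Fin n, QuadraticMap.polar (cliffForm n) (Pi.single a 1) (Pi.single b 1) =
        if a = b then -2 else 0 := fun a b => by
      simp [polar_cliffForm, Pi.single_apply, eq_comm]
    simp only [h2, Pi.sub_apply, Pi.smul_apply, smul_eq_mul, Pi.single_apply,
      Matrix.mulVec_single_one, Matrix.col_apply, Matrix.smul_apply, Matrix.sub_apply,
      Matrix.single_apply, eq_comm (a := l), ite_and]
    split_ifs <;> norm_num

theorem spinRep_surjective_skew {Z : Matrix (Fin n) (Fin n) ℝ} (hZ : Z.transpose = -Z) :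
    ∃ X, spinRep n X = Z := by
  have h : ∀ i j, (2 : ℝ) • (Matrix.single j i 1 - Matrix.single i j 1) ∈
    LinearMap.range (spinRep n) := fun i j => exists_spinRep_eq_single_sub i j
  -- The generators carry a factor 2 and each unordered pair of indices occurs twice, whence `1/4`;
  -- the sign is that of `E_ji - E_ij`.
  have e : Z = ∑ i, ∑ j, (-(1 / 4) * Z i j) •
      ((2 : ℝ) • (Matrix.single j i 1 - Matrix.single i j (1 : ℝ))) := by
    ext k l
    have hkl : Z l k = - Z k l := congrFun (congrFun hZ k) l
    simp [Matrix.sum_apply, Matrix.single_apply, mul_sub, Finset.sum_sub_distrib, ite_and, hkl]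
    ring
  rw [e]
  exact Submodule.sum_mem _ fun i _ => Submodule.sum_mem _ fun j _ => Submodule.smul_mem _ _ (h i j)

theorem isShulmanRep_spinRep_iff (hn : 3 ≤ n) {c : ℝ} (hc : c ≠ 0) (Φ : Tot (spinGrp n) 4) :
    IsShulmanRep (spinGrp n) (pontryaginForm (spinGrp n) (spinRep n)) Φ ↔
      Φ = (-(1 / (8 * ((n : ℝ) - 2) * c * Real.pi ^ 2))) •
        symplecticForm (spinGrp n) (c • killing (spinGrp n)) :=
  isShulmanRep_pontryaginForm_iff hn hc _ (spinRep n) spinRep_injective spinRep_lie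
    transpose_spinRep (fun _ hZ => spinRep_surjective_skew hZ) Φ

end Spin

end BGForms

end

theorem mainTheorem7 (n : ℕ) (hn : 3 ≤ n) (c : ℝ) (hc : c ≠ 0) :
    (∀ Φ : BGForms.Tot (BGForms.orthGroup n) 4,
      BGForms.IsShulmanRep (BGForms.orthGroup n)
          (BGForms.pontryaginForm (BGForms.orthGroup n)
            (BGForms.matrixRep (BGForms.orthGroup n))) Φ ↔
        Φ = (-(1 / (8 * ((n : ℝ) - 2) * c * Real.pi ^ 2))) •
          BGForms.symplecticForm (BGForms.orthGroup n)
            (c • BGForms.killing (BGForms.orthGroup n))) ∧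
    (∀ Φ : BGForms.Tot (BGForms.specialOrthGroup n) 4,
      BGForms.IsShulmanRep (BGForms.specialOrthGroup n)
          (BGForms.pontryaginForm (BGForms.specialOrthGroup n)
            (BGForms.matrixRep (BGForms.specialOrthGroup n))) Φ ↔
        Φ = (-(1 / (8 * ((n : ℝ) - 2) * c * Real.pi ^ 2))) •
          BGForms.symplecticForm (BGForms.specialOrthGroup n)
            (c • BGForms.killing (BGForms.specialOrthGroup n))) ∧
    (∀ Φ : BGForms.Tot (BGForms.spinGrp n) 4,
      BGForms.IsShulmanRep (BGForms.spinGrp n)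
          (BGForms.pontryaginForm (BGForms.spinGrp n) (BGForms.spinRep n)) Φ ↔
        Φ = (-(1 / (8 * ((n : ℝ) - 2) * c * Real.pi ^ 2))) •
          BGForms.symplecticForm (BGForms.spinGrp n)
            (c • BGForms.killing (BGForms.spinGrp n))) := by
  exact ⟨fun Φ => BGForms.isShulmanRep_matrixRep_iff hn hc BGForms.specialOrthGroup_le_orthGroup le_rfl Φ,
    fun Φ => BGForms.isShulmanRep_matrixRep_iff hn hc le_rfl
      BGForms.specialOrthGroup_le_orthGroup Φ,
    fun Φ => BGForms.isShulmanRep_spinRep_iff hn hc Φ⟩
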